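/- **Setting.** Let $\mathcal S$ be a finite set and $E:\mathcal S\to\mathbb R$ an injective energy function. For each $\beta>0$ let $\mathbf P_\beta=(p_\beta(r,s))_{r,s\in\mathcal S}$ be an irreducible stochastic matrix with $p_\beta(s,s)>0$ for all $s$, which is reversible with respect to a stationary distribution $\pi_\beta$: $\pi_\beta(r)p_\beta(r,s)=\pi_\beta(s)p_\beta(s,r)$. Assume that for $r\ne s$ the condition $p_\beta(r,s)>0$ does not depend on $\beta$ and is symmetric in $r,s$; in this case $r,s$ are called neighbours, $r\sim s$, and this makes $\mathcal S$ a graph. Assume that there are $\gamma_\beta>0$ with $\gamma_\beta\to0$ and $\beta\gamma_\beta\to\infty$ as $\beta\to\infty$ such that for all sufficiently large $\beta$ and all $r\sim s$ $$e^{-\beta((E(s)-E(r))^++\gamma_\beta/|\mathcal S|)}\le p_\beta(r,s)\le e^{-\beta((E(s)-E(r))^+-\gamma_\beta/|\mathcal S|)},$$ and that for all $r,s$ with $r\sim s$ or $r=s$ the limit $\lim_{\beta\to\infty}p_\beta(r,s)$ exists, is positive if $E(r)\ge E(s)$, and is $0$ otherwise. Let $X=(X_k)_{k\ge0}$ be,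 under $\mathbb P_r=\mathbb P_r^{\beta}$, a Markov chain with transition matrix $\mathbf P_\beta$ and $X_0=r$, with expectation $\mathbb E_r$. **Saddles.** For $r,s\in\mathcal S$ let $E(z^*(r,s))$ be the minimum, over all self-avoiding paths from $r$ to $s$ in the graph, of the maximal energy along the path (endpoints included; $E(z^*(s,s))=E(s)$); paths attaining the minimum are called minimal. **Metastable states.** Let $m^{(1)},\dots,m^{(\mathfrak n)}$ be an enumeration of the local minima of $E$ (the states $s$ with $E(s)<E(r)$ for all $r\sim s$) and put $M^{(i)}=\{m^{(i)},\dots,m^{(\mathfrak n)}\}$. Assume that for every $1\le i<\mathfrak n$ the state $m^{(i)}$ has minimal activation energy in $M^{(i)}$, that is, it minimizes $x\mapsto\min_{y\in M^{(i)}\setminus\{x\}}E(z^*(x,y))-E(x)$ over $x\in M^{(i)}$ (ties may be broken in any way). **Valleys.** For $1\le i\le\mathfrak n$ and $m\in M^{(i)}$ let $V_<^{(i)}(m)=\{s: E(z^*(s,m))<E(z^*(s,m'))\ \text{for all } m'\in M^{(i)}\setminus\{m\}\}$. A state $s$ is attracted by $m$ at level $i$, written $s\leadsto m$ at level $i$,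 if $E(z^*(s,m))=\min_{m'\in M^{(i)}}E(z^*(s,m'))$ and every minimal path from $s$ to a state $m'\in M^{(i)}\setminus\{m\}$ with $E(z^*(s,m'))=E(z^*(s,m))$ hits $V^{(i)}_<(m)$. Let $l(j)=\inf\{k: j<k\le\mathfrak n,\ m^{(j)}\leadsto m' \text{ at level } k\text{ for some }m'\in M^{(k)}\}$. The valleys are defined by $V^{(1)}(m)=\{s: s\leadsto m\text{ at level }1\}$ for $m\in M^{(1)}$ and, for $2\le i\le\mathfrak n$ and $m\in M^{(i)}$, $$V^{(i)}(m)=V^{(i-1)}(m)\cup\{s\in N^{(i-1)}: s\leadsto m\text{ at level }i\}\cup\bigcup_{j:\,l(j)=i,\ m^{(j)}\leadsto m\text{ at level }i}V^{(j)}(m^{(j)}),$$ where $N^{(i)}=\mathcal S\setminus\bigcup_{j=1}^{\mathfrak n}V^{(\min(i,j))}(m^{(j)})$ is the set of non-assigned states at level $i$. The outer boundary $\partial^+V$ of $V\subset\mathcal S$ is the set of states outside $V$ that have a neighbour in $V$. **Exit time.** For fixed $i$ let $\xi_0=\inf\{k\ge0: X_k\notin N^{(i)}\}$ and $\zeta_0=\inf\{k\ge\xi_0: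 X_k\in N^{(i)}\}$. **Theorem.** Let $1\le i<\mathfrak n$ and $m\in M^{(i)}$. Then $\partial^+V^{(i)}(m)$ is non-empty, so that it has a unique state $s_m$ of lowest energy, and for every $r\in V^{(i)}(m)$ the expectation $\mathbb E_r\zeta_0$ is finite for all $\beta>0$ and $$\lim_{\beta\to\infty}\frac1\beta\ln\mathbb E_r\zeta_0=E(s_m)-E(m).$$ -/

import Mathlib

open Filter Topology MeasureTheory
open scoped ENNReal BigOperators

noncomputable section

namespace EnergyValleys

/-! ### The Markov chains -/

/-- A family of finite reversible Markov chains, with transition matrices `P β` and stationary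
distributions `π β` for `β > 0`, driven by the energy function `E`. The simple graph `G` is the
neighbourhood graph: distinct states `r, s` are neighbours iff `P β r s > 0` (the same
graph for every `β`; since `G` is undirected, `P β r s > 0` iff `P β s r > 0`). -/
structure IsEnergyDrivenChain {S : Type*} [Fintype S] (G : SimpleGraph S) (E : S → ℝ)
    (P : ℝ → Matrix S S ℝ) (π : ℝ → S → ℝ) (γ : ℝ → ℝ) : Prop where
  row_sum : ∀ β : ℝ, 0 < β → ∀ r, ∑ s, P β r s = 1
  irreducible : ∀ β : ℝ, 0 < β → (P β).IsIrreducible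
  self_pos : ∀ β : ℝ, 0 < β → ∀ s, 0 < P β s s
  pos_iff_adj : ∀ β : ℝ, 0 < β → ∀ r s, r ≠ s → (0 < P β r s ↔ G.Adj r s)
  gamma_pos : ∀ β : ℝ, 0 < β → 0 < γ β
  gamma_tendsto : Tendsto γ atTop (𝓝 0)
  mul_gamma_tendsto : Tendsto (fun β => β * γ β) atTop atTop
  lower_bound : ∀ᶠ β in atTop, ∀ r s, G.Adj r s →
    Real.exp (-β * (max (E s - E r) 0 + γ β / Fintype.card S)) ≤ P β r s
  upper_bound : ∀ᶠ β in atTop, ∀ r s, G.Adj r s →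
    P β r s ≤ Real.exp (-β * (max (E s - E r) 0 - γ β / Fintype.card S))
  limit_downhill : ∀ r s, (r = s ∨ G.Adj r s) → E s ≤ E r →
    ∃ c : ℝ, 0 < c ∧ Tendsto (fun β => P β r s) atTop (𝓝 c)
  limit_uphill : ∀ r s, G.Adj r s → E r < E s → Tendsto (fun β => P β r s) atTop (𝓝 0)
  stationary_nonneg : ∀ β : ℝ, 0 < β → ∀ s, 0 ≤ π β s
  stationary_sum : ∀ β : ℝ, 0 < β → ∑ s, π β s = 1
  stationary : ∀ β : ℝ, 0 < β → ∀ s, ∑ r, π β r * P β r s = π β s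
  detailed_balance : ∀ β : ℝ, 0 < β → ∀ r s, π β r * P β r s = π β s * P β s r
  nondegenerate : Function.Injective E

/-- Under the probability measure `μ`, the process `X` is a (time-homogeneous) Markov chain with
transition matrix `p` started at `r`. -/
structure IsMarkovChain {S Ω : Type*} [MeasurableSpace Ω] (μ : Measure Ω) (X : ℕ → Ω → S)
    (p : Matrix S S ℝ) (r : S) : Prop where
  prob : IsProbabilityMeasure μ
  measurable : ∀ n s, MeasurableSet {ω | X n ω = s}
  start : ∀ᵐ ω ∂μ, X 0 ω = r
  markov : ∀ (n : ℕ) (x : ℕ → S) (s : S),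
    μ {ω | (∀ k ≤ n, X k ω = x k) ∧ X (n + 1) ω = s}
      = μ {ω | ∀ k ≤ n, X k ω = x k} * ENNReal.ofReal (p (x n) s)

/-! ### Minimal paths and essential saddles -/

/-- The maximal energy along a path, endpoints included. -/
def pathHeight {S : Type*} {G : SimpleGraph S} (E : S → ℝ) {r s : S} (p : G.Path r s) : ℝ :=
  sSup (E '' {t | t ∈ p.1.support})

/-- A self-avoiding path is minimal if its maximal energy is minimal among all self-avoiding
paths with the same endpoints. -/
def IsMinimalPath {S : Type*} {G : SimpleGraph S} (E : S → ℝ) {r s : S} (p : G.Path r s) : Prop :=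
  ∀ q : G.Path r s, pathHeight E p ≤ pathHeight E q

/-- `z` is an essential saddle between `r` and `s`: the state of maximal energy on a minimal
path from `r` to `s`. -/
def IsEssentialSaddle {S : Type*} (G : SimpleGraph S) (E : S → ℝ) (r s z : S) : Prop :=
  ∃ p : G.Path r s, IsMinimalPath E p ∧ z ∈ p.1.support ∧ ∀ t ∈ p.1.support, E t ≤ E z

/-- The energy `E (z* r s)` of the essential saddle between `r` and `s`, that is, the smallest
maximal energy of a self-avoiding path from `r` to `s`. (For `r = s` this is `E r`.) -/
def saddleEnergy {S : Type*} (G : SimpleGraph S) (E : S → ℝ) (r s : S) : ℝ :=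
  ⨅ p : G.Path r s, pathHeight E p

theorem IsEssentialSaddle.saddleEnergy_eq {S : Type*} {G : SimpleGraph S} {E : S → ℝ} {r s z : S}
    (h : IsEssentialSaddle G E r s z) : saddleEnergy G E r s = E z := by
  obtain ⟨p, hp, hz, hmax⟩ := h
  have hpz : pathHeight E p = E z := by
    apply IsGreatest.csSup_eq
    refine ⟨⟨z, hz, rfl⟩, ?_⟩
    rintro _ ⟨t, ht, rfl⟩
    exact hmax t ht
  rw [← hpz]
  have : Nonempty (G.Path r s) := ⟨p⟩
  apply le_antisymm
  · refine ciInf_le ⟨pathHeight E p, ?_⟩ p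
    rintro _ ⟨q, rfl⟩
    exact hp q
  · exact le_ciInf hp

/-! ### The metastable states -/

/-- The local minima of the energy. -/
def localMinima {S : Type*} (G : SimpleGraph S) (E : S → ℝ) : Set S :=
  {s | ∀ r, G.Adj s r → E s < E r}

/-- `M⁽ⁱ⁾ = {m⁽ⁱ⁾, …, m⁽ⁿ⁾}`, the metastable states of level `i`. -/
def metastable {S : Type*} (m : ℕ → S) (n i : ℕ) : Set S := m '' Set.Icc i n

/-- The activation energy of `x`: the energy barrier that has to be overcome for a transition from
`x` to another element of `M`. -/
def activationEnergy {S : Type*} (G : SimpleGraph S) (E : S → ℝ) (M : Set S) (x : S) : ℝ :=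
  sInf ((fun y => saddleEnergy G E x y - E x) '' (M \ {x}))

/-- `m⁽¹⁾, …, m⁽ⁿ⁾` is an enumeration of the local minima such that `M⁽ⁱ⁺¹⁾` arises from `M⁽ⁱ⁾` by
deleting an element `m⁽ⁱ⁾` with minimal activation energy. -/
structure IsMetastableOrder {S : Type*} (G : SimpleGraph S) (E : S → ℝ) (m : ℕ → S) (n : ℕ) :
    Prop where
  injOn : Set.InjOn m (Set.Icc 1 n)
  range_eq : metastable m n 1 = localMinima G E
  minimal : ∀ i, 1 ≤ i → i < n → ∀ x ∈ metastable m n i,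
    activationEnergy G E (metastable m n i) (m i) ≤ activationEnergy G E (metastable m n i) x

/-! ### Attraction and valleys -/

/-- `V_<⁽ⁱ⁾(x)` for `M = M⁽ⁱ⁾`. -/
def strictBasin {S : Type*} (G : SimpleGraph S) (E : S → ℝ) (M : Set S) (x : S) : Set S :=
  {s | ∀ y ∈ M, y ≠ x → saddleEnergy G E s x < saddleEnergy G E s y}

/-- `s` is attracted by `x ∈ M` at level `i`, where `M = M⁽ⁱ⁾`. -/
def Attracted {S : Type*} (G : SimpleGraph S) (E : S → ℝ) (M : Set S) (s x : S) : Prop :=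
  x ∈ M ∧ (∀ y ∈ M, saddleEnergy G E s x ≤ saddleEnergy G E s y) ∧
    ∀ y ∈ M, y ≠ x → saddleEnergy G E s y = saddleEnergy G E s x →
      ∀ p : G.Path s y, IsMinimalPath E p → ∃ t ∈ p.1.support, t ∈ strictBasin G E M x

/-- `l(j) = i`: the level `i` is the smallest one above `j` at which `m⁽ʲ⁾` is attracted by an
element of `M⁽ⁱ⁾`. -/
def IsMergeLevel {S : Type*} (G : SimpleGraph S) (E : S → ℝ) (m : ℕ → S) (n j i : ℕ) : Prop :=
  IsLeast {k | j < k ∧ k ≤ n ∧ ∃ x ∈ metastable m n k, Attracted G E (metastable m n k) (m j) x} i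

/-- The valley `V⁽ⁱ⁾(x)` of order `i ≥ 1` containing `x ∈ M⁽ⁱ⁾`. At level `i + 2` the second set of
the union consists of the states that are non-assigned at level `i + 1` and attracted by `x` at
level `i + 2`. -/
def valley {S : Type*} (G : SimpleGraph S) (E : S → ℝ) (m : ℕ → S) (n : ℕ) : ℕ → S → Set S
  | 0, _ => ∅
  | 1, x => {s | Attracted G E (metastable m n 1) s x}
  | i + 2, x =>
      valley G E m n (i + 1) x
      ∪ {s | s ∈ (⋃ j ∈ Set.Icc 1 n, valley G E m n (min (i + 1) j) (m j))ᶜ ∧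
          Attracted G E (metastable m n (i + 2)) s x}
      ∪ ⋃ (j : ℕ) (_ : 1 ≤ j ∧ j < i + 2) (_ : IsMergeLevel G E m n j (i + 2) ∧
          Attracted G E (metastable m n (i + 2)) (m j) x), valley G E m n j (m j)
  termination_by i => i
  decreasing_by all_goals omega

/-- The set `N⁽ⁱ⁾` of non-assigned states at level `i`. -/
def nonAssigned {S : Type*} (G : SimpleGraph S) (E : S → ℝ) (m : ℕ → S) (n i : ℕ) : Set S :=
  (⋃ j ∈ Set.Icc 1 n, valley G E m n (min i j) (m j))ᶜ

/-- The outer boundary `∂⁺V`: the states outside `V` that are adjacent to a state in `V`. -/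
def outerBoundary {S : Type*} (G : SimpleGraph S) (V : Set S) : Set S :=
  {s | s ∉ V ∧ ∃ r ∈ V, G.Adj r s}

/-! ### Entrance and exit times -/

/-- `inf {k ≥ a | X_k ∈ A}`, with value `⊤` if there is no such `k`. -/
def firstTime {S Ω : Type*} (X : ℕ → Ω → S) (A : Set S) (a : ℕ∞) (ω : Ω) : ℕ∞ :=
  ⨅ (k : ℕ) (_ : a ≤ k ∧ X k ω ∈ A), (k : ℕ∞)

/-- The first entrance time `ξ₀ = inf {k ≥ 0 | X_k ∉ N}` into a valley. -/
def entranceTime {S Ω : Type*} (X : ℕ → Ω → S) (N : Set S) (ω : Ω) : ℕ∞ :=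
  firstTime X Nᶜ 0 ω

/-- The first exit time `ζ₀ = inf {k ≥ ξ₀ | X_k ∈ N}` from a valley. -/
def exitTime {S Ω : Type*} (X : ℕ → Ω → S) (N : Set S) (ω : Ω) : ℕ∞ :=
  firstTime X N (entranceTime X N ω) ω

/-- The expectation of a random time, as an extended nonnegative real. -/
def expectedTime {Ω : Type*} [MeasurableSpace Ω] (μ : Measure Ω) (τ : Ω → ℕ∞) : ℝ≥0∞ :=
  ∫⁻ ω, ((τ ω : ℕ∞) : ℝ≥0∞) ∂μ

end EnergyValleys

end

/-! Write V for the valley of `x` and H for the smallest saddle energy from `x` to another state of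
M⁽ⁱ⁾. The rate H - E(x) splits the theorem into a geometric part and a probabilistic part.

Geometry. Saddle energies are ultrametric, because walks below a given height can be concatenated.
This shows that attraction passes from a state to the state attracting it (`Attracted.transfer`),
that valleys are nested or disjoint (`valley_subset_of_mem`), and that every state of the outer
boundary of V is non-assigned (`mem_nonAssigned_of_adj`). Leaving the valleys from V therefore means
leaving V. The lowest state of the outer boundary has energy exactly H: a minimal walk to another
metastable state must cross the boundary, and a boundary state below H would already have been
absorbed into V (`le_of_mem_outerBoundary`).

Potential theory. The expected exit time is the solution f on V of (1 - p) f = 1 with value 0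
outside V. It is compared with Green functions, and these are bounded by conductances; the
conductance of an edge, relative to the weight of u, is exp(-β (height of the edge - E(u))) up to
the factors exp(±3βγ), where the height is the larger energy of its two ends.

Upper bound. From every state u the complement of V is reached over a barrier of at most H - E(x). A
deeper lake inside V would have a local minimum at its bottom that was deleted too early, against
the ordering by minimal activation energy (`exists_saddleEnergy_sub_le`). Hence every diagonal Green
function is at most |S| exp(β(H - E(x)) + 3βγ), and f is bounded by their sum.

Lower bound. The lake of `x` below H lies in V and is left only through edges of height at least H,
so the Green function at `x` is large, and so is f(x). For other starting points r in V, the chain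
visits `x` before leaving V with probability bounded away from zero, so f(x) ≤ c f(r)
(`eventually_le_of_mem_valley`). After taking logarithms and dividing by β, the errors vanish
because γ → 0. -/

noncomputable section

namespace EnergyValleys

/-! ### Saddle energies through walks of bounded energy -/

/-- `s` and `t` are joined by a walk all of whose states satisfy `Q`. -/
def Linked {S : Type*} (G : SimpleGraph S) (Q : S → Prop) (s t : S) : Prop :=
  ∃ w : G.Walk s t, ∀ v ∈ w.support, Q v

section Linked

variable {S : Type*} {G : SimpleGraph S} {Q R : S → Prop} {s t u : S}

theorem Linked.refl (h : Q s) : Linked G Q s s := ⟨.nil, by simpa using h⟩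

theorem Linked.symm (h : Linked G Q s t) : Linked G Q t s := by
  obtain ⟨w, hw⟩ := h
  exact ⟨w.reverse, by simpa using hw⟩

theorem Linked.trans (h : Linked G Q s t) (h' : Linked G Q t u) : Linked G Q s u := by
  obtain ⟨w, hw⟩ := h
  obtain ⟨w', hw'⟩ := h'
  refine ⟨w.append w', fun v hv => ?_⟩
  rcases (SimpleGraph.Walk.mem_support_append_iff w w').1 hv with hv | hv
  exacts [hw v hv, hw' v hv]

theorem Linked.cons (h : G.Adj s t) (hs : Q s) (h' : Linked G Q t u) : Linked G Q s u := by
  obtain ⟨w, hw⟩ := h'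
  refine ⟨.cons h w, fun v hv => ?_⟩
  rw [SimpleGraph.Walk.support_cons, List.mem_cons] at hv
  rcases hv with rfl | hv
  exacts [hs, hw v hv]

theorem Linked.adj (h : G.Adj s t) (hs : Q s) (ht : Q t) : Linked G Q s t :=
  .cons h hs (.refl ht)

theorem Linked.mono (hQ : ∀ v, Q v → R v) (h : Linked G Q s t) : Linked G R s t := by
  obtain ⟨w, hw⟩ := h
  exact ⟨w, fun v hv => hQ v (hw v hv)⟩

theorem Linked.left (h : Linked G Q s t) : Q s := by
  obtain ⟨w, hw⟩ := h
  exact hw s w.start_mem_support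

theorem Linked.right (h : Linked G Q s t) : Q t := h.symm.left

/-- Strengthening the predicate along a walk by the fact that its states are linked to its ends. -/
theorem Linked.enrich (h : Linked G Q s t) :
    Linked G (fun v => Q v ∧ Linked G Q s v ∧ Linked G Q v t) s t := by
  obtain ⟨w, hw⟩ := h
  classical
  refine ⟨w, fun v hv => ⟨hw v hv, ⟨w.takeUntil v hv, fun u hu => ?_⟩,
    ⟨w.dropUntil v hv, fun u hu => ?_⟩⟩⟩
  · exact hw u (w.support_takeUntil_subset_support hv hu)
  · exact hw u (w.support_dropUntil_subset_support hv hu)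

/-- A walk either avoids a set, or can be stopped at its first visit. -/
theorem Linked.avoid_or_hit (B : Set S) (h : Linked G Q s t) :
    Linked G (fun v => Q v ∧ v ∉ B) s t ∨
      ∃ u ∈ B, Linked G (fun v => v = u ∨ Linked G (fun v => Q v ∧ v ∉ B) s v) s u ∧
        Linked G Q u t := by
  obtain ⟨w, hw⟩ := h
  induction w with
  | @nil a =>
    by_cases ha : a ∈ B
    · exact .inr ⟨a, ha, .refl (.inl rfl), .refl (hw a (by simp))⟩
    · exact .inl (.refl ⟨hw a (by simp), ha⟩)
  | @cons a b c hab w ih =>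
    have haQ : Q a := hw a (by simp)
    have hw' : ∀ v ∈ w.support, Q v := fun v hv => hw v (by simp [hv])
    by_cases ha : a ∈ B
    · exact .inr ⟨a, ha, .refl (.inl rfl), .cons hab haQ ⟨w, hw'⟩⟩
    · rcases ih hw' with h | ⟨u, hu, h, h'⟩
      · exact .inl (.cons hab ⟨haQ, ha⟩ h)
      · refine .inr ⟨u, hu, .cons hab (.inr (.refl ⟨haQ, ha⟩)) (h.mono fun v hv => ?_), h'⟩
        exact hv.imp_right (.cons hab ⟨haQ, ha⟩)

/-- A walk from inside a set to its complement leaves the set through an edge. -/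
theorem Linked.exists_exit (V : Set S) (h : Linked G Q s t) (hs : s ∈ V) (ht : t ∉ V) :
    ∃ a b, a ∈ V ∧ b ∉ V ∧ G.Adj a b ∧ Q a ∧ Q b := by
  obtain ⟨w, hw⟩ := h
  induction w with
  | nil => exact absurd hs ht
  | @cons a b c hab w ih =>
    by_cases hb : b ∈ V
    · exact ih hb ht fun v hv => hw v (by simp [hv])
    · exact ⟨a, b, hs, hb, hab, hw a (by simp), hw b (by simp)⟩

/-- An edge-closed property spreads along walks. -/
theorem Linked.spread (h : Linked G Q s t) (hs : R s)
    (hR : ∀ a b, R a → G.Adj a b → Q b → R b) : R t := by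
  by_contra ht
  obtain ⟨a, b, ha, hb, hab, -, hQ⟩ := h.exists_exit {v | R v} hs ht
  exact hb (hR a b ha hab hQ)

end Linked

section Saddle

variable {S : Type*} [Finite S] {G : SimpleGraph S} {E : S → ℝ}

theorem le_pathHeight {r s t : S} (p : G.Path r s) (ht : t ∈ p.1.support) :
    E t ≤ pathHeight E p :=
  le_csSup (Set.toFinite _).bddAbove ⟨t, ht, rfl⟩

theorem pathHeight_le_iff {r s : S} (p : G.Path r s) {H : ℝ} :
    pathHeight E p ≤ H ↔ ∀ t ∈ p.1.support, E t ≤ H := by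
  refine ⟨fun h t ht => (le_pathHeight p ht).trans h, fun h => csSup_le ?_ ?_⟩
  · exact ⟨E r, r, p.1.start_mem_support, rfl⟩
  · rintro _ ⟨t, ht, rfl⟩
    exact h t ht

theorem bddBelow_pathHeight (r s : S) :
    BddBelow (Set.range fun p : G.Path r s => pathHeight E p) :=
  ⟨E r, by rintro _ ⟨p, rfl⟩; exact le_pathHeight p p.1.start_mem_support⟩

theorem pathHeight_mem_range {r s : S} (p : G.Path r s) : pathHeight E p ∈ Set.range E := by
  obtain ⟨t, -, ht⟩ := Set.Nonempty.csSup_mem (s := E '' {t | t ∈ p.1.support})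
    ⟨E r, r, p.1.start_mem_support, rfl⟩ (Set.toFinite _)
  exact ⟨t, ht⟩

theorem exists_pathHeight_eq (hG : G.Connected) (r s : S) :
    ∃ p : G.Path r s, pathHeight E p = saddleEnergy G E r s := by
  obtain ⟨w⟩ := hG.preconnected r s
  classical
  have : Nonempty (G.Path r s) := ⟨w.toPath⟩
  have hfin : (Set.range fun p : G.Path r s => pathHeight E p).Finite :=
    (Set.finite_range E).subset (by rintro _ ⟨p, rfl⟩; exact pathHeight_mem_range p)
  exact (Set.range_nonempty _).csInf_mem hfin

/-- Heights take finitely many values, so the infimum is attained, and erasing the loops of a walk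
only removes states. Since walks concatenate and reverse freely, symmetry and the ultrametric
inequality follow from this. -/
theorem saddleEnergy_le_iff (hG : G.Connected) {r s : S} {H : ℝ} :
    saddleEnergy G E r s ≤ H ↔ Linked G (fun v => E v ≤ H) r s := by
  constructor
  · intro h
    obtain ⟨p, hp⟩ := exists_pathHeight_eq (E := E) hG r s
    exact ⟨p.1, (pathHeight_le_iff p).1 (hp.trans_le h)⟩
  · rintro ⟨w, hw⟩
    classical
    refine (ciInf_le (bddBelow_pathHeight r s) w.toPath).trans ((pathHeight_le_iff _).2 ?_)
    exact fun t ht => hw t (w.support_toPath_subset_support ht)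

theorem linked_saddleEnergy (hG : G.Connected) (r s : S) :
    Linked G (fun v => E v ≤ saddleEnergy G E r s) r s :=
  (saddleEnergy_le_iff hG).1 le_rfl

theorem saddleEnergy_comm (hG : G.Connected) (r s : S) :
    saddleEnergy G E r s = saddleEnergy G E s r :=
  le_antisymm ((saddleEnergy_le_iff hG).2 (linked_saddleEnergy hG s r).symm)
    ((saddleEnergy_le_iff hG).2 (linked_saddleEnergy hG r s).symm)

theorem saddleEnergy_trans (hG : G.Connected) {r s t : S} {H : ℝ}
    (h : saddleEnergy G E r s ≤ H) (h' : saddleEnergy G E s t ≤ H) : saddleEnergy G E r t ≤ H :=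
  (saddleEnergy_le_iff hG).2
    (((saddleEnergy_le_iff hG).1 h).trans ((saddleEnergy_le_iff hG).1 h'))

theorem saddleEnergy_trans_lt (hG : G.Connected) {r s t : S} {H : ℝ}
    (h : saddleEnergy G E r s < H) (h' : saddleEnergy G E s t < H) : saddleEnergy G E r t < H :=
  (saddleEnergy_trans hG (le_max_left _ _) (le_max_right _ _)).trans_lt (max_lt h h')

theorem left_le_saddleEnergy (hG : G.Connected) (r s : S) : E r ≤ saddleEnergy G E r s :=
  (linked_saddleEnergy hG r s).left

theorem right_le_saddleEnergy (hG : G.Connected) (r s : S) : E s ≤ saddleEnergy G E r s :=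
  (linked_saddleEnergy hG r s).right

theorem saddleEnergy_self (hG : G.Connected) (r : S) : saddleEnergy G E r r = E r :=
  le_antisymm ((saddleEnergy_le_iff hG).2 (.refl le_rfl)) (left_le_saddleEnergy hG r r)

theorem saddleEnergy_adj_le (hG : G.Connected) {r s : S} {H : ℝ} (h : G.Adj r s) (hr : E r ≤ H)
    (hs : E s ≤ H) : saddleEnergy G E r s ≤ H :=
  (saddleEnergy_le_iff hG).2 (.adj h hr hs)

/-- The two largest sides of an ultrametric triangle are equal. -/
theorem saddleEnergy_eq_of_lt (hG : G.Connected) {r s t : S}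
    (h : saddleEnergy G E r s < saddleEnergy G E r t) :
    saddleEnergy G E s t = saddleEnergy G E r t := by
  have h1 : saddleEnergy G E s t ≤ saddleEnergy G E r t :=
    saddleEnergy_trans hG (saddleEnergy_comm hG r s ▸ h.le) le_rfl
  refine le_antisymm h1 (le_of_not_gt fun h2 => ?_)
  exact lt_irrefl _ (saddleEnergy_trans_lt hG h h2)

/-- A walk of minimal height, with the saddle energies of its states to both ends. -/
theorem linked_minimal (hG : G.Connected) {r s : S} {H : ℝ} (h : saddleEnergy G E r s ≤ H) :
    Linked G (fun v => E v ≤ H ∧ saddleEnergy G E r v ≤ saddleEnergy G E r s ∧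
      saddleEnergy G E v s ≤ saddleEnergy G E r s) r s := by
  refine (linked_saddleEnergy (E := E) hG r s).enrich.mono ?_
  rintro v ⟨h1, h2, h3⟩
  exact ⟨h1.trans h, (saddleEnergy_le_iff hG).2 h2, (saddleEnergy_le_iff hG).2 h3⟩

/-- A walk realising the saddle has to leave `r` through a neighbour, and all neighbours are
strictly higher. -/
theorem lt_saddleEnergy_of_localMin (hG : G.Connected) {r s : S} (hr : r ∈ localMinima G E)
    (h : r ≠ s) : E r < saddleEnergy G E r s := by
  obtain ⟨a, b, ha, hb, hab, -, hQ⟩ :=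
    (linked_saddleEnergy (E := E) hG r s).exists_exit {r} rfl fun h' => h h'.symm
  rw [Set.mem_singleton_iff] at ha
  subst ha
  exact (hr b hab).trans_le hQ

end Saddle

/-! ### Attraction -/

section Attraction

variable {S : Type*} {G : SimpleGraph S} {E : S → ℝ} {M M' : Set S}
  {a x y s t u v : S}

theorem strictBasin_anti (h : M' ⊆ M) : strictBasin G E M a ⊆ strictBasin G E M' a :=
  fun _ hs y hy => hs y (h hy)

theorem attracted_of_mem_strictBasin (ha : a ∈ M) (hs : s ∈ strictBasin G E M a) :
    Attracted G E M s a := by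
  refine ⟨ha, fun y hy => ?_, fun y hy hya h => absurd h (hs y hy hya).ne'⟩
  by_cases hya : y = a
  · rw [hya]
  · exact (hs y hy hya).le

variable [Finite S]

/-- A walk that stays below the saddle to `a` and ends in `M` shortens to a minimal path with fewer
states, so minimal paths can be replaced by walks of bounded height, which are easier to compose. -/
theorem attracted_iff (hG : G.Connected) : Attracted G E M s a ↔
    a ∈ M ∧ (∀ y ∈ M, saddleEnergy G E s a ≤ saddleEnergy G E s y) ∧
      ∀ y ∈ M, y ≠ a →
        ¬ Linked G (fun v => E v ≤ saddleEnergy G E s a ∧ v ∉ strictBasin G E M a) s y := by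
  refine and_congr_right fun _ => and_congr_right fun h2 => ?_
  constructor
  · rintro h3 y hy hya ⟨w, hw⟩
    have hle : saddleEnergy G E s y ≤ saddleEnergy G E s a :=
      (saddleEnergy_le_iff hG).2 ⟨w, fun v hv => (hw v hv).1⟩
    have heq := le_antisymm hle (h2 y hy)
    classical
    have hmin : IsMinimalPath E w.toPath := fun q => by
      have h1 : pathHeight E w.toPath ≤ saddleEnergy G E s y := by
        rw [heq]
        exact (pathHeight_le_iff _).2 fun t ht =>
          (hw t (w.support_toPath_subset_support ht)).1
      exact h1.trans (ciInf_le (bddBelow_pathHeight s y) q)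
    obtain ⟨t, ht, htB⟩ := h3 y hy hya heq _ hmin
    exact (hw t (w.support_toPath_subset_support ht)).2 htB
  · intro h3 y hy hya heq p hp
    by_contra! hcon
    obtain ⟨q, hq⟩ := exists_pathHeight_eq (E := E) hG s y
    refine h3 y hy hya ⟨p.1, fun v hv => ⟨?_, hcon v hv⟩⟩
    exact (le_pathHeight p hv).trans ((hp q).trans (hq.trans heq).le)

/-- By the ultrametric identity, a move over a barrier lower than the saddle to `y` leaves that
saddle unchanged. -/
theorem strictBasin_of_lt (hG : G.Connected) (hu : u ∈ strictBasin G E M a)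
    (h : ∀ y ∈ M, y ≠ a → saddleEnergy G E u v < saddleEnergy G E u y) :
    v ∈ strictBasin G E M a := by
  intro y hy hya
  have h1 := h y hy hya
  rw [saddleEnergy_eq_of_lt hG h1]
  refine saddleEnergy_trans_lt hG ?_ (hu y hy hya)
  rwa [saddleEnergy_comm hG]

theorem strictBasin_of_le (hG : G.Connected) (hu : u ∈ strictBasin G E M a)
    (h : saddleEnergy G E u v ≤ saddleEnergy G E u a) : v ∈ strictBasin G E M a :=
  strictBasin_of_lt hG hu fun y hy hya => h.trans_lt (hu y hy hya)

theorem self_mem_strictBasin (hG : G.Connected) (hM : M ⊆ localMinima G E) (ha : a ∈ M) :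
    a ∈ strictBasin G E M a := fun y hy hya => by
  rw [saddleEnergy_self hG]
  exact lt_saddleEnergy_of_localMin hG (hM ha) hya.symm

theorem attracted_self (hG : G.Connected) (hM : M ⊆ localMinima G E) (ha : a ∈ M) :
    Attracted G E M a a :=
  attracted_of_mem_strictBasin ha (self_mem_strictBasin hG hM ha)

/-- Attraction spreads along walks below the saddle that do not enter the strict basin. -/
theorem Attracted.of_linked (hG : G.Connected) (hs : Attracted G E M s a)
    (h : Linked G (fun v => E v ≤ saddleEnergy G E s a ∧ v ∉ strictBasin G E M a) s v) :
    Attracted G E M v a := by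
  obtain ⟨ha, -, h3⟩ := (attracted_iff hG).1 hs
  have hsv : saddleEnergy G E s v ≤ saddleEnergy G E s a :=
    (saddleEnergy_le_iff hG).2 (h.mono fun _ h => h.1)
  have hva : saddleEnergy G E v a ≤ saddleEnergy G E s a :=
    saddleEnergy_trans hG (saddleEnergy_comm hG s v ▸ hsv) le_rfl
  refine (attracted_iff hG).2 ⟨ha, fun y hy => ?_, fun y hy hya hl => ?_⟩
  · by_contra! hlt
    have hya : y ≠ a := by rintro rfl; exact lt_irrefl _ hlt
    -- A visit `w` to the strict basin would allow a detour to `a` that is no higher than the walk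
    -- to `y`.
    rcases (linked_minimal (E := E) hG (hlt.le.trans hva)).avoid_or_hit (strictBasin G E M a) with
      hl | ⟨w, hw, -, hl⟩
    · exact h3 y hy hya (h.trans (hl.mono fun _ h => ⟨h.1.1, h.2⟩))
    · have h1 := hw y hy hya
      have h2 := hl.left
      exact hlt.not_ge (saddleEnergy_trans hG h2.2.1 (h1.le.trans h2.2.2))
  · exact h3 y hy hya (h.trans (hl.mono fun _ h => ⟨h.1.trans hva, h.2⟩))

theorem Attracted.of_adj (hG : G.Connected) (hs : Attracted G E M s a) (hst : G.Adj s t)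
    (ht : E t ≤ saddleEnergy G E s a) : Attracted G E M t a := by
  have hsE := left_le_saddleEnergy (E := E) hG s a
  by_cases hsB : s ∈ strictBasin G E M a
  · exact attracted_of_mem_strictBasin hs.1
      (strictBasin_of_le hG hsB (saddleEnergy_adj_le hG hst hsE ht))
  by_cases htB : t ∈ strictBasin G E M a
  · exact attracted_of_mem_strictBasin hs.1 htB
  exact hs.of_linked hG (.adj hst ⟨hsE, hsB⟩ ⟨ht, htB⟩)

/-- If `s` is attracted by `a` with respect to `M`, and `t`, which is `s` or close to `s`, is
attracted by `x` with respect to the smaller set `M'`, then `a` is attracted by `x`. -/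
theorem Attracted.transfer (hG : G.Connected) (hMl : M ⊆ localMinima G E) (hM : M' ⊆ M)
    (hs : Attracted G E M s a) (ht : Attracted G E M' t x)
    (hts : t = s ∨ G.Adj t s) (hsa : saddleEnergy G E s a ≤ saddleEnergy G E t x) :
    Attracted G E M' a x := by
  obtain ⟨ha, -, hs3⟩ := (attracted_iff hG).1 hs
  obtain ⟨hx, ht2, ht3⟩ := (attracted_iff hG).1 ht
  have haB := self_mem_strictBasin hG hMl ha
  -- Both remaining clauses reduce to this one: if some `y` were strictly closer to `a` than `x`, a
  -- minimal walk to `y` would miss the strict basin of `x`.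
  suffices key : ∀ y ∈ M', y ≠ x → saddleEnergy G E a y ≤ saddleEnergy G E a x →
      ¬ Linked G (fun v => E v ≤ saddleEnergy G E a x ∧ v ∉ strictBasin G E M' x) a y by
    refine (attracted_iff hG).2 ⟨hx, fun y hy => ?_, fun y hy hyx hl => ?_⟩
    · by_contra! hlt
      have hyx : y ≠ x := by rintro rfl; exact lt_irrefl _ hlt
      rcases (linked_minimal (E := E) hG hlt.le).avoid_or_hit (strictBasin G E M' x) with
        hl | ⟨w, hw, -, hl⟩
      · exact key y hy hyx hlt.le (hl.mono fun _ h => ⟨h.1.1, h.2⟩)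
      · have h1 := hw y hy hyx
        have h2 := hl.left
        exact hlt.not_ge (saddleEnergy_trans hG h2.2.1 (h1.le.trans h2.2.2))
    · exact key y hy hyx ((saddleEnergy_le_iff hG).2 (hl.mono fun _ h => h.1)) hl
  intro y hy hyx hay hl
  have hEs : E s ≤ saddleEnergy G E t x := (left_le_saddleEnergy hG s a).trans hsa
  have hEt : E t ≤ saddleEnergy G E t x := left_le_saddleEnergy hG t x
  have hst : saddleEnergy G E s t ≤ saddleEnergy G E t x := by
    rcases hts with rfl | h
    · rwa [saddleEnergy_self hG]
    · exact saddleEnergy_adj_le hG h.symm hEs hEt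
  have hax : saddleEnergy G E a x ≤ saddleEnergy G E t x :=
    saddleEnergy_trans hG (saddleEnergy_comm hG s a ▸ hsa) (saddleEnergy_trans hG hst le_rfl)
  have hty : saddleEnergy G E t y ≤ saddleEnergy G E t x :=
    saddleEnergy_trans hG (saddleEnergy_comm hG s t ▸ hst)
      (saddleEnergy_trans hG hsa (hay.trans hax))
  have htB : t ∉ strictBasin G E M' x := fun h => hty.not_gt (h y hy hyx)
  -- From a state of the strict basin of `a`, the saddles to `x` and `y` are those seen from `a`,
  -- where `y` is not harder to reach than `x`.
  have hdisj : ∀ v ∈ strictBasin G E M a, v ∉ strictBasin G E M' x := by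
    intro v hv hv'
    have hxa : x ≠ a := by rintro rfl; exact hl.left.2 (strictBasin_anti hM haB)
    have h1 := hv' y hy hyx
    have h2 := hv x (hM hx) hxa
    by_cases hya : y = a
    · subst hya
      exact lt_asymm h1 h2
    · rw [← saddleEnergy_eq_of_lt hG h2, ← saddleEnergy_eq_of_lt hG (hv y (hM hy) hya)] at h1
      exact h1.not_ge hay
  -- Up to the first visit to the strict basin of `a`, attraction of `s` by `a` keeps the walk away
  -- from that of `x`; afterwards the walk stays inside the strict basin of `a`.
  have hlink : Linked G (fun v => E v ≤ saddleEnergy G E s a ∧ v ∉ strictBasin G E M' x) s a := by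
    have hav : ∀ v, Linked G (fun v => E v ≤ saddleEnergy G E s a ∧
        v ∉ strictBasin G E M a) s v → v ∉ strictBasin G E M' x := by
      intro v hsv hvB
      have h1 := hvB y hy hyx
      have hva : saddleEnergy G E v a ≤ saddleEnergy G E s a :=
        saddleEnergy_trans hG ((saddleEnergy_le_iff hG).2 (hsv.symm.mono fun _ h => h.1)) le_rfl
      rcases le_or_gt (saddleEnergy G E v x) (saddleEnergy G E s a) with hvx | hvx
      · have hxa : x ≠ a := by rintro rfl; exact hl.left.2 (strictBasin_anti hM haB)
        rcases (linked_minimal (E := E) hG hvx).avoid_or_hit (strictBasin G E M a) with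
          hl | ⟨w, hw, -, hl⟩
        · exact hs3 x (hM hx) hxa (hsv.trans (hl.mono fun _ h => ⟨h.1.1, h.2⟩))
        · have h2 := hl.left.2.1
          have h3 := hl.left.2.2
          have h4 := hw x (hM hx) hxa
          have hwy : saddleEnergy G E w y ≤ saddleEnergy G E w x := by
            by_cases hya : y = a
            · subst hya
              exact h4.le
            · rw [← saddleEnergy_eq_of_lt hG h4, ← saddleEnergy_eq_of_lt hG (hw y (hM hy) hya)]
              exact hay
          exact h1.not_ge (saddleEnergy_trans hG h2 (hwy.trans h3))
      · have h2 := saddleEnergy_eq_of_lt hG (hva.trans_lt hvx)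
        exact h1.not_ge (saddleEnergy_trans hG (hva.trans hvx.le) (hay.trans h2.le))
    rcases (linked_saddleEnergy (E := E) hG s a).avoid_or_hit (strictBasin G E M a) with
      hl | ⟨w, hw, hl, hl'⟩
    · exact absurd haB hl.right.2
    · refine Linked.trans (t := w) (hl.mono ?_) ?_
      · rintro v (rfl | hv)
        · exact ⟨hl'.left, hdisj v hw⟩
        · exact ⟨hv.right.1, hav v hv⟩
      · have hwa : saddleEnergy G E w a ≤ saddleEnergy G E s a := (saddleEnergy_le_iff hG).2 hl'
        refine (linked_minimal (E := E) hG hwa).mono fun v hv => ⟨hv.1, hdisj v ?_⟩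
        exact strictBasin_of_le hG hw hv.2.1
  -- The composite walk from `t` through `s` and `a` to `y` contradicts the attraction of `t` by
  -- `x`.
  refine ht3 y hy hyx (Linked.trans (t := a) ?_ (hl.mono fun _ h => ⟨h.1.trans hax, h.2⟩))
  have hl2 := hlink.mono (R := fun v => E v ≤ saddleEnergy G E t x ∧ v ∉ strictBasin G E M' x)
    fun _ h => ⟨h.1.trans hsa, h.2⟩
  rcases hts with rfl | h
  · exact hl2
  · exact .cons h ⟨hEt, htB⟩ hl2

theorem Attracted.eq_of_mem (hG : G.Connected) (hM : M ⊆ localMinima G E) (ha : a ∈ M)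
    (h : Attracted G E M a x) : a = x := by
  by_contra hax
  have h1 := h.2.1 a ha
  rw [saddleEnergy_self hG] at h1
  exact h1.not_gt (lt_saddleEnergy_of_localMin hG (hM ha) hax)

theorem Attracted.transfer_self (hG : G.Connected) (hMl : M ⊆ localMinima G E) (hM : M' ⊆ M)
    (hs : Attracted G E M s a) (ht : Attracted G E M' s x) : Attracted G E M' a x :=
  hs.transfer hG hMl hM ht (.inl rfl) (hs.2.1 x (hM ht.1))

theorem Attracted.unique (hG : G.Connected) (hM : M ⊆ localMinima G E)
    (h : Attracted G E M s a) (h' : Attracted G E M s x) : a = x :=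
  (h.transfer_self hG hM subset_rfl h').eq_of_mem hG hM h.1

/-- Either `t` is low enough for the attraction of `s` to spread to it, or `t` lies above the saddle
between `s` and `a`, and then `a` is reached from `t` at no extra cost. This is what separates
valleys. -/
theorem Attracted.adj_dichotomy (hG : G.Connected) (hMl : M ⊆ localMinima G E) (hM : M' ⊆ M)
    (hst : G.Adj s t) (hs : Attracted G E M s a) (ht : Attracted G E M' t x) :
    Attracted G E M t a ∨ Attracted G E M' a x := by
  rcases le_or_gt (E t) (saddleEnergy G E s a) with h | h
  · exact .inl (hs.of_adj hG hst h)
  · exact .inr (hs.transfer hG hMl hM ht (.inr hst.symm)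
      (h.le.trans (left_le_saddleEnergy hG t x)))

end Attraction

/-! ### Valleys -/

section Valley

variable {S : Type*} {G : SimpleGraph S} {E : S → ℝ} {m : ℕ → S} {n i j k : ℕ}
  {a x y s t u v : S}

theorem metastable_anti (h : j ≤ k) : metastable m n k ⊆ metastable m n j :=
  Set.image_mono (Set.Icc_subset_Icc_left h)

theorem IsMetastableOrder.subset (hm : IsMetastableOrder G E m n) (hi : 1 ≤ i) :
    metastable m n i ⊆ localMinima G E := hm.range_eq ▸ metastable_anti hi

theorem IsMetastableOrder.index_eq (hm : IsMetastableOrder G E m n) (hj : 1 ≤ j) (hjn : j ≤ n)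
    (hk : 1 ≤ k) (hkn : k ≤ n) (h : m j = m k) : j = k :=
  hm.injOn ⟨hj, hjn⟩ ⟨hk, hkn⟩ h

/-- Recursive description of membership in a valley. -/
theorem mem_valley_succ (hi : 1 ≤ i) : s ∈ valley G E m n (i + 1) x ↔
    s ∈ valley G E m n i x ∨
    (s ∈ nonAssigned G E m n i ∧ Attracted G E (metastable m n (i + 1)) s x) ∨
    ∃ j, 1 ≤ j ∧ j ≤ i ∧ IsMergeLevel G E m n j (i + 1) ∧
      Attracted G E (metastable m n (i + 1)) (m j) x ∧ s ∈ valley G E m n j (m j) := by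
  obtain ⟨i, rfl⟩ : ∃ i', i = i' + 1 := ⟨i - 1, by omega⟩
  rw [valley]
  simp only [Set.mem_union, Set.mem_iUnion, or_assoc, nonAssigned, exists_prop, Set.mem_ofPred_eq]
  refine or_congr_right (or_congr_right (exists_congr fun j => ?_))
  rw [Nat.lt_succ_iff]
  tauto

theorem mem_valley_one : s ∈ valley G E m n 1 x ↔ Attracted G E (metastable m n 1) s x := by
  rw [valley]
  rfl

theorem mem_nonAssigned : s ∈ nonAssigned G E m n i ↔
    ∀ j, 1 ≤ j → j ≤ n → s ∉ valley G E m n (min i j) (m j) := by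
  simp only [nonAssigned, Set.mem_compl_iff, Set.mem_iUnion, Set.mem_Icc, exists_prop, not_exists,
    not_and, and_imp]

/-- An induction principle for the states of a valley. -/
theorem valley_induction {p : ℕ → S → S → Prop}
    (attr : ∀ k x s, 1 ≤ k → Attracted G E (metastable m n k) s x → p k x s)
    (mono : ∀ k x s, 1 ≤ k → s ∈ valley G E m n k x → p k x s → p (k + 1) x s)
    (merge : ∀ k j x s, 1 ≤ j → j < k → IsMergeLevel G E m n j k →
      Attracted G E (metastable m n k) (m j) x → s ∈ valley G E m n j (m j) →
      p j (m j) s → p k x s)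
    (hk : 1 ≤ k) (hs : s ∈ valley G E m n k x) : p k x s := by
  induction k using Nat.strong_induction_on generalizing x s with
  | _ k ih =>
    rcases hk.eq_or_lt with rfl | hk
    · exact attr 1 x s le_rfl (mem_valley_one.1 hs)
    obtain ⟨k, rfl⟩ : ∃ k', k = k' + 1 := ⟨k - 1, by omega⟩
    have hk' : 1 ≤ k := by omega
    rcases (mem_valley_succ hk').1 hs with h | ⟨-, h⟩ | ⟨j, hj, hjk, hl, hja, h⟩
    · exact mono k x s hk' h (ih k (by omega) hk' h)
    · exact attr _ x s (by omega) h
    · exact merge _ j x s hj (by omega) hl hja h (ih j (by omega) hj h)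

theorem valley_mono (hj : 1 ≤ j) (hjk : j ≤ k) : valley G E m n j x ⊆ valley G E m n k x := by
  induction k, hjk using Nat.le_induction with
  | base => exact subset_rfl
  | succ k hk ih => exact fun s hs => (mem_valley_succ (by omega)).2 (.inl (ih hs))

theorem valley_subset_of_merge (hj : 1 ≤ j) (hl : IsMergeLevel G E m n j k)
    (ha : Attracted G E (metastable m n k) (m j) x) :
    valley G E m n j (m j) ⊆ valley G E m n k x := by
  have hjk := hl.1.1
  obtain ⟨k, rfl⟩ : ∃ k', k = k' + 1 := ⟨k - 1, by omega⟩
  exact fun s hs => (mem_valley_succ (by omega)).2 (.inr (.inr ⟨j, hj, by omega, hl, ha, hs⟩))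

theorem exists_mergeLevel (hjk : j < k) (hkn : k ≤ n)
    (ha : Attracted G E (metastable m n k) (m j) x) : ∃ l ≤ k, IsMergeLevel G E m n j l := by
  classical
  have hex : ∃ k, j < k ∧ k ≤ n ∧ ∃ x ∈ metastable m n k,
      Attracted G E (metastable m n k) (m j) x := ⟨k, hjk, hkn, x, ha.1, ha⟩
  exact ⟨Nat.find hex, Nat.find_min' hex ⟨hjk, hkn, x, ha.1, ha⟩, Nat.find_spec hex,
    fun l hl => Nat.find_min' hex hl⟩

theorem mem_of_mem_metastable (hx : x ∈ metastable m n i) : i ≤ n := by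
  obtain ⟨q, hq, -⟩ := hx
  exact hq.1.trans hq.2

theorem metastable_diff_nonempty (hm : IsMetastableOrder G E m n) (hi : 1 ≤ i) (hin : i < n)
    (x : S) : (metastable m n i \ {x}).Nonempty := by
  by_cases h : m i = x
  · refine ⟨m (i + 1), ⟨i + 1, ⟨by omega, hin⟩, rfl⟩, fun h' => ?_⟩
    have := hm.index_eq (by omega) hin hi hin.le (h'.trans h.symm)
    omega
  · exact ⟨m i, ⟨i, ⟨le_rfl, hin.le⟩, rfl⟩, h⟩

/-- Every state of a valley was attracted when it was first assigned. -/
theorem exists_attracted_of_mem_valley (hk : 1 ≤ k) (hs : s ∈ valley G E m n k x) : ∃ l b, 1 ≤ l ∧ l ≤ k ∧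
      Attracted G E (metastable m n l) s b ∧ valley G E m n l b ⊆ valley G E m n k x := by
  refine valley_induction (p := fun k x s => ∃ l b, 1 ≤ l ∧ l ≤ k ∧
      Attracted G E (metastable m n l) s b ∧ valley G E m n l b ⊆ valley G E m n k x)
      ?_ ?_ ?_ hk hs
  · exact fun k x s hk h => ⟨k, x, hk, le_rfl, h, subset_rfl⟩
  · rintro k x s hk _ ⟨l, b, hl, hlk, h, hsub⟩
    exact ⟨l, b, hl, by omega, h, hsub.trans (valley_mono hk (by omega))⟩
  · rintro k j x s hj hjk hlev hja _ ⟨l, b, hl, hlk, h, hsub⟩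
    exact ⟨l, b, hl, by omega, h, hsub.trans (valley_subset_of_merge hj hlev hja)⟩

variable [Finite S]

/-- A state of a valley that is attracted by `x` at a later level passes this on to the metastable
state of the valley. -/
theorem Attracted.of_mem_valley (hG : G.Connected) (hm : IsMetastableOrder G E m n)
    (hk : 1 ≤ k) (hs : s ∈ valley G E m n k a) (hki : k ≤ i)
    (h : Attracted G E (metastable m n i) s x) : Attracted G E (metastable m n i) a x := by
  refine valley_induction (p := fun k a s => ∀ x, k ≤ i →
    Attracted G E (metastable m n i) s x → Attracted G E (metastable m n i) a x)
    ?_ ?_ ?_ hk hs x hki h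
  · exact fun k a s hk hs x hki h => hs.transfer_self hG (hm.subset hk) (metastable_anti hki) h
  · exact fun k a s _ _ ih x hki h => ih x (by omega) h
  · intro k j a s hj hjk _ hja _ ih x hki h
    exact hja.transfer_self hG (hm.subset (by omega)) (metastable_anti hki) (ih x (by omega) h)

/-- The self-attraction of `a` is passed on to `x`, which as a metastable state can only be
attracted by itself. -/
theorem eq_of_mem_valley (hG : G.Connected) (hm : IsMetastableOrder G E m n) (hi : 1 ≤ i)
    (ha : a ∈ metastable m n i) (h : a ∈ valley G E m n i x) (hx : x ∈ metastable m n i) :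
    a = x :=
  (Attracted.eq_of_mem hG (hm.subset hi) hx
    (Attracted.of_mem_valley hG hm hi h le_rfl (attracted_self hG (hm.subset hi) ha))).symm

/-- Merging preserves the inequality: both legs of the route from `s` to `x` through `m j` are no
higher than the saddle from `s` to `y`. -/
theorem saddleEnergy_le_of_mem_valley (hG : G.Connected) (hk : 1 ≤ k)
    (hs : s ∈ valley G E m n k x) :
    ∀ y ∈ metastable m n k, saddleEnergy G E s x ≤ saddleEnergy G E s y := by
  refine valley_induction (p := fun k x s => ∀ y ∈ metastable m n k,
    saddleEnergy G E s x ≤ saddleEnergy G E s y) ?_ ?_ ?_ hk hs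
  · exact fun k x s _ h => h.2.1
  · exact fun k x s _ _ ih y hy => ih y (metastable_anti (by omega) hy)
  · intro k j x s _ hjk _ hja _ ih y hy
    have h1 := ih y (metastable_anti hjk.le hy)
    refine saddleEnergy_trans hG h1 ((hja.2.1 y hy).trans (saddleEnergy_trans hG ?_ le_rfl))
    rwa [saddleEnergy_comm hG]

/-- A state attracted by `x` belongs to the valley of `x`. -/
theorem mem_valley_of_attracted (hG : G.Connected) (hm : IsMetastableOrder G E m n) (hi : 1 ≤ i)
    (h : Attracted G E (metastable m n i) s x) : s ∈ valley G E m n i x := by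
  rcases hi.eq_or_lt with rfl | hi'
  · exact mem_valley_one.2 h
  obtain ⟨i, rfl⟩ : ∃ i', i = i' + 1 := ⟨i - 1, by omega⟩
  have hin := mem_of_mem_metastable h.1
  by_cases hN : s ∈ nonAssigned G E m n i
  · exact (mem_valley_succ (by omega)).2 (.inr (.inl ⟨hN, h⟩))
  rw [mem_nonAssigned] at hN
  push Not at hN
  obtain ⟨j, hj, hjn, hsj⟩ := hN
  -- Follow the chain of mergers starting with a valley that already contains `s`. Each metastable
  -- state met is attracted by `x`, and the indices increase, so the chain ends at `x`; `d` is the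
  -- decreasing measure `n - j`.
  have key : ∀ d j, d + j = n → 1 ≤ j → s ∈ valley G E m n (min i j) (m j) →
      s ∈ valley G E m n (i + 1) x := by
    intro d
    induction d using Nat.strong_induction_on with
    | _ d ih =>
      intro j hd hj hs
      have hjn : j ≤ n := by omega
      have hja := Attracted.of_mem_valley hG hm (by omega) hs (by omega) h
      rcases lt_or_ge i j with hij | hij
      · have hx : m j = x := hja.eq_of_mem hG (hm.subset hi) ⟨j, ⟨hij, hjn⟩, rfl⟩
        rw [min_eq_left hij.le, hx] at hs
        exact valley_mono (by omega) (by omega) hs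
      · rw [min_eq_right hij] at hs
        obtain ⟨l, hl, hlev⟩ := exists_mergeLevel (by omega) hin hja
        obtain ⟨hjl, hln, y, hy, hya⟩ := hlev.1
        have hsy := valley_subset_of_merge hj hlev hya hs
        obtain ⟨q, hq, rfl⟩ := hy
        rcases hl.eq_or_lt with rfl | hl
        · rwa [hja.unique hG (hm.subset hi) hya]
        · refine ih (n - q) ?_ q ?_ ?_ ?_
          all_goals have := hq.1
          all_goals have := hq.2
          · omega
          · omega
          · omega
          · exact valley_mono (by omega) (by omega) hsy
  exact key (n - j) j (by omega) hj hsj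

theorem self_mem_valley (hG : G.Connected) (hm : IsMetastableOrder G E m n) (hi : 1 ≤ i)
    (hx : x ∈ metastable m n i) : x ∈ valley G E m n i x :=
  mem_valley_of_attracted hG hm hi (attracted_self hG (hm.subset hi) hx)

/-- A former metastable state in a later valley has been merged. -/
theorem exists_mergeLevel_of_mem_valley (hG : G.Connected) (hm : IsMetastableOrder G E m n)
    (hj : 1 ≤ j) (hjk : j < k) (ha : a ∈ metastable m n k) (h : m j ∈ valley G E m n k a) :
    ∃ l ≤ k, IsMergeLevel G E m n j l := by
  have hkn := mem_of_mem_metastable ha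
  induction k using Nat.strong_induction_on generalizing a with
  | _ k ih =>
  obtain ⟨k, rfl⟩ : ∃ k', k = k' + 1 := ⟨k - 1, by omega⟩
  have hjn : j ≤ n := by omega
  have hself : m j ∈ valley G E m n j (m j) :=
    self_mem_valley hG hm hj ⟨j, ⟨le_rfl, hjn⟩, rfl⟩
  have hne : ∀ q, 1 ≤ q → q < k + 1 → q ≠ j → m j ≠ m q := fun q hq hqk hqj h =>
    hqj (hm.index_eq hj hjn hq (by omega) h).symm
  rcases (mem_valley_succ (by omega)).1 h with h | ⟨h, -⟩ | ⟨q, hq, hqk, hl, hqa, h⟩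
  · have ha' := metastable_anti (Nat.le_succ k) ha
    rcases (Nat.lt_succ_iff.1 hjk).eq_or_lt with rfl | hjk'
    · have := eq_of_mem_valley hG hm hj ⟨j, ⟨le_rfl, hjn⟩, rfl⟩ h ha'
      obtain ⟨q, hq, rfl⟩ := ha
      have := hm.index_eq hj hjn (hj.trans (hjk.le.trans hq.1)) hq.2 this
      have := hq.1
      omega
    · obtain ⟨l, hl, h⟩ := ih k (by omega) hjk' ha' h (by omega)
      exact ⟨l, by omega, h⟩
  · exact absurd (by rwa [min_eq_right (by omega)]) (mem_nonAssigned.1 h j hj hjn)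
  · rcases lt_trichotomy j q with hjq | rfl | hjq
    · obtain ⟨l, hl, h⟩ := ih q (by omega) hjq ⟨q, ⟨le_rfl, by omega⟩, rfl⟩ h (by omega)
      exact ⟨l, by omega, h⟩
    · exact ⟨_, le_rfl, hl⟩
    · exact absurd (eq_of_mem_valley hG hm hq ⟨j, ⟨hjq.le, hjn⟩, rfl⟩ h
        ⟨q, ⟨le_rfl, by omega⟩, rfl⟩) (hne q hq (by omega) (by omega))

/-- Valleys are nested or disjoint. -/
theorem valley_subset_of_mem (hG : G.Connected) (hm : IsMetastableOrder G E m n)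
    (hk : 1 ≤ k) (hki : k ≤ i) (ha : a ∈ metastable m n k) (hx : x ∈ metastable m n i)
    (hs : s ∈ valley G E m n k a) (hs' : s ∈ valley G E m n i x) :
    valley G E m n k a ⊆ valley G E m n i x := by
  have hin := mem_of_mem_metastable hx
  induction i using Nat.strong_induction_on generalizing k a x s with
  | _ i ih =>
  rcases (hk.trans hki).eq_or_lt with rfl | hi
  · obtain rfl : k = 1 := by omega
    rw [(mem_valley_one.1 hs).unique hG (hm.subset le_rfl) (mem_valley_one.1 hs')]
  obtain ⟨i, rfl⟩ : ∃ i', i = i' + 1 := ⟨i - 1, by omega⟩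
  have hi1 : 1 ≤ i := by omega
  have hMl := hm.subset (hi1.trans (Nat.le_succ i))
  have hmem : ∀ j, j ≤ i → m j ∈ metastable m n j := fun j hj => ⟨j, ⟨le_rfl, by omega⟩, rfl⟩
  have hself : ∀ j, 1 ≤ j → j ≤ i → m j ∈ valley G E m n j (m j) := fun j hj hji =>
    self_mem_valley hG hm hj (hmem j hji)
  -- If `j < q`, nestedness at the lower level puts `m j` into the valley of `m q`, so `m j` would
  -- have merged by level `q`, too early for merge level `i + 1`.
  have hnest : ∀ j q, 1 ≤ j → j ≤ q → q ≤ i → IsMergeLevel G E m n j (i + 1) →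
      s ∈ valley G E m n j (m j) → s ∈ valley G E m n q (m q) → j = q := by
    intro j q hj hjq hqi hl hsj hsq
    by_contra hne
    have h1 := ih q (by omega) hj hjq (hmem j (by omega)) (hmem q hqi) hsj hsq (by omega)
      (hself j hj (by omega))
    obtain ⟨l, hlq, h2⟩ := exists_mergeLevel_of_mem_valley hG hm hj (by omega) (hmem q hqi) h1
    have := hl.unique h2
    omega
  rcases hki.eq_or_lt with rfl | hki
  · suffices h : a = x by rw [h]
    -- Here the valley of `m j` sits inside the old valley of `a`, so the attraction of `m j` by `x`
    -- is inherited by `a`, which forces `a = x`.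
    have hold : ∀ a x, a ∈ metastable m n (i + 1) → x ∈ metastable m n (i + 1) →
        s ∈ valley G E m n i a → ∀ j, 1 ≤ j → j ≤ i →
        Attracted G E (metastable m n (i + 1)) (m j) x → s ∈ valley G E m n j (m j) → a = x := by
      intro a x ha hx hsa j hj hji hjx hsj
      have h1 := ih i (by omega) hj hji (hmem j hji) (metastable_anti (Nat.le_succ i) ha) hsj hsa
        (by omega) (hself j hj hji)
      exact (Attracted.of_mem_valley hG hm hi1 h1 (by omega) hjx).eq_of_mem hG hMl ha
    rcases (mem_valley_succ hi1).1 hs' with h' | ⟨-, h'⟩ | ⟨j', hj', hji', hl', hja', h'⟩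
    · rcases (mem_valley_succ hi1).1 hs with h | ⟨-, h⟩ | ⟨j, hj, hji, hl, hja, h⟩
      · have ha' := metastable_anti (Nat.le_succ i) ha
        have h1 := ih i (by omega) hi1 le_rfl ha' (metastable_anti (Nat.le_succ i) hx) h h'
          (by omega) (self_mem_valley hG hm hi1 ha')
        exact eq_of_mem_valley hG hm (by omega) ha (valley_mono hi1 (by omega) h1) hx
      · exact ((Attracted.of_mem_valley hG hm hk hs' le_rfl h).eq_of_mem hG hMl hx).symm
      · exact (hold x a hx ha h' j hj hji hja h).symm
    · exact (Attracted.of_mem_valley hG hm hk hs le_rfl h').eq_of_mem hG hMl ha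
    · rcases (mem_valley_succ hi1).1 hs with h | ⟨-, h⟩ | ⟨j, hj, hji, hl, hja, h⟩
      · exact hold a x ha hx h j' hj' hji' hja' h'
      · exact ((Attracted.of_mem_valley hG hm hk hs' le_rfl h).eq_of_mem hG hMl hx).symm
      · obtain rfl : j = j' := by
          rcases le_total j j' with hle | hle
          · exact hnest j j' hj hle hji' hl h h'
          · exact (hnest j' j hj' hle hji hl' h' h).symm
        exact hja.unique hG hMl hja'
  · rw [Nat.lt_succ_iff] at hki
    rcases (mem_valley_succ hi1).1 hs' with h' | ⟨h', -⟩ | ⟨j, hj, hji, hl, hja, h'⟩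
    · exact (ih i (by omega) hk hki ha (metastable_anti (Nat.le_succ i) hx) hs h'
        (by omega)).trans (valley_mono hi1 (by omega))
    · obtain ⟨q, hq, rfl⟩ := ha
      have := hq.1
      exact absurd (valley_mono hk (by omega) hs) (mem_nonAssigned.1 h' q (by omega) hq.2)
    · have hjx := valley_subset_of_merge hj hl hja
      rcases le_or_gt k j with hkj | hjk
      · exact (ih j (by omega) hk hkj ha (hmem j hji) hs h' (by omega)).trans hjx
      · have h1 := ih k (by omega) hj hjk.le (hmem j hji) ha h' hs (by omega) (hself j hj hji)
        obtain ⟨l, hlk, h2⟩ := exists_mergeLevel_of_mem_valley hG hm hj hjk ha h1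
        have := hl.unique h2
        omega

/-- The valleys of the current level are separated by non-assigned states. -/
theorem mem_nonAssigned_of_adj (hG : G.Connected) (hm : IsMetastableOrder G E m n) (hi : 1 ≤ i)
    (hx : x ∈ metastable m n i) (hs : s ∈ valley G E m n i x) (hst : G.Adj s t)
    (ht : t ∉ valley G E m n i x) : t ∈ nonAssigned G E m n i := by
  rw [mem_nonAssigned]
  intro q hq hqn htq
  obtain ⟨k, a, hk, hki, hsa, hsub⟩ := exists_attracted_of_mem_valley hi hs
  obtain ⟨l, b, hl, hli, htb, -⟩ := exists_attracted_of_mem_valley (le_min hi hq) htq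
  have hli : l ≤ i := by omega
  have haV : a ∈ valley G E m n k a := self_mem_valley hG hm hk hsa.1
  have htV := mem_valley_of_attracted hG hm hl htb
  have hsV := mem_valley_of_attracted hG hm hk hsa
  -- In both cases either attraction crosses the edge, or the attracting state of the earlier level
  -- is attracted at the later one. The valley of `b` then meets that of `x` and is nested in it, or
  -- `t` lies in the valley of `x` directly.
  rcases le_total k l with hkl | hlk
  · rcases hsa.adj_dichotomy hG (hm.subset hk) (metastable_anti hkl) hst htb with h | h
    · exact ht (hsub (mem_valley_of_attracted hG hm hk h))
    · exact ht (valley_subset_of_mem hG hm hl hli htb.1 hx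
        (mem_valley_of_attracted hG hm hl h) (hsub haV) htV)
  · rcases htb.adj_dichotomy hG (hm.subset hl) (metastable_anti hlk) hst.symm hsa with h | h
    · exact ht (valley_subset_of_mem hG hm hl hli htb.1 hx
        (mem_valley_of_attracted hG hm hl h) hs htV)
    · exact ht (valley_subset_of_mem hG hm hl hli htb.1 hx
        (self_mem_valley hG hm hl htb.1) (hsub (mem_valley_of_attracted hG hm hk h)) htV)

end Valley

/-! ### Activation energies, depths and boundaries of valleys -/

section Depth

variable {S : Type*} [Finite S] {G : SimpleGraph S} {E : S → ℝ} {m : ℕ → S} {n i j k : ℕ}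
  {a x y s t u v : S} {M M' : Set S} {H : ℝ}

theorem activationEnergy_le (hy : y ∈ M) (hyx : y ≠ x) :
    activationEnergy G E M x ≤ saddleEnergy G E x y - E x :=
  csInf_le (Set.toFinite _).bddBelow ⟨y, ⟨hy, hyx⟩, rfl⟩

theorem exists_activationEnergy_eq (h : (M \ {x}).Nonempty) :
    ∃ y ∈ M, y ≠ x ∧ activationEnergy G E M x = saddleEnergy G E x y - E x := by
  obtain ⟨y, hy, h⟩ := (h.image fun y => saddleEnergy G E x y - E x).csInf_mem (Set.toFinite _)
  exact ⟨y, hy.1, hy.2, h.symm⟩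

theorem activationEnergy_anti (hM : M' ⊆ M) (h : (M' \ {x}).Nonempty) :
    activationEnergy G E M x ≤ activationEnergy G E M' x := by
  obtain ⟨y, hy, hyx, heq⟩ := exists_activationEnergy_eq (G := G) (E := E) h
  exact heq ▸ activationEnergy_le (hM hy) hyx

/-- Minimal activation energies increase with the level. -/
theorem activationEnergy_le_of_le (hm : IsMetastableOrder G E m n) (hj : 1 ≤ j) (hji : j ≤ i)
    (hin : i < n) (hx : x ∈ metastable m n i) :
    activationEnergy G E (metastable m n j) (m j) ≤
      activationEnergy G E (metastable m n i) x :=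
  (hm.minimal j hj (by omega) (m i) ⟨i, ⟨hji, hin.le⟩, rfl⟩).trans
    ((activationEnergy_anti (metastable_anti hji)
      (metastable_diff_nonempty hm (by omega) hin _)).trans (hm.minimal i (by omega) hin x hx))

/-- The state of lowest energy in a lake is a local minimum. -/
theorem exists_bottom (hG : G.Connected) (hE : Function.Injective E) (hu : E u < H) :
    ∃ b ∈ localMinima G E, saddleEnergy G E u b < H ∧
      ∀ v, saddleEnergy G E u v < H → E b ≤ E v := by
  have hu' : saddleEnergy G E u u < H := by rwa [saddleEnergy_self hG]
  obtain ⟨b, hb, hmin⟩ := Set.exists_min_image {v | saddleEnergy G E u v < H} E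
    (Set.toFinite _) ⟨u, hu'⟩
  refine ⟨b, fun r hr => ?_, hb, hmin⟩
  have hbH : E b < H := (hmin u hu').trans_lt hu
  rcases lt_or_ge (E r) H with h | h
  · have h1 : saddleEnergy G E b r < H :=
      (saddleEnergy_adj_le hG hr (le_max_left _ _) (le_max_right _ _)).trans_lt (max_lt hbH h)
    exact lt_of_le_of_ne (hmin r (saddleEnergy_trans_lt hG hb h1)) fun h => hr.ne (hE h)
  · exact hbH.trans_le h

/-- A lake without metastable states of level `i` is part of a valley of an earlier level. -/
theorem exists_lake_subset_valley (hG : G.Connected) (hE : Function.Injective E)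
    (hm : IsMetastableOrder G E m n) (hu : E u < H)
    (hL : ∀ y ∈ metastable m n i, H ≤ saddleEnergy G E u y) :
    ∃ p, 1 ≤ p ∧ p < i ∧ p ≤ n ∧
      ∀ v, saddleEnergy G E u v < H → v ∈ valley G E m n p (m p) := by
  classical
  obtain ⟨b, hb, hub, -⟩ := exists_bottom hG hE hu
  rw [← hm.range_eq] at hb
  obtain ⟨q, hq, rfl⟩ := hb
  -- Take the local minimum of the lake that survives longest: at level `p` it is the only
  -- metastable state in the lake, so the whole lake lies in its strict basin.
  obtain ⟨p, hp, hmax⟩ := Finset.exists_max_image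
    ((Finset.Icc 1 n).filter fun q => saddleEnergy G E u (m q) < H) id ⟨q, by simp_all⟩
  simp only [Finset.mem_filter, Finset.mem_Icc, id, and_imp] at hp hmax
  obtain ⟨⟨hp1, hpn⟩, hpH⟩ := hp
  refine ⟨p, hp1, ?_, hpn, fun v hv => ?_⟩
  · by_contra! hip
    exact hpH.not_ge (hL (m p) ⟨p, ⟨hip, hpn⟩, rfl⟩)
  · refine mem_valley_of_attracted hG hm hp1
      (attracted_of_mem_strictBasin ⟨p, ⟨le_rfl, hpn⟩, rfl⟩ ?_)
    rintro _ ⟨q, hq, rfl⟩ hqp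
    have hvu : saddleEnergy G E v u < H := by rwa [saddleEnergy_comm hG]
    refine (saddleEnergy_trans_lt hG hvu hpH).trans_le ?_
    by_contra! hvq
    have h1 := hmax q (by have := hq.1; omega) hq.2 (saddleEnergy_trans_lt hG hv hvq)
    exact hqp (by rw [le_antisymm h1 hq.1])

/-- From every state of a valley, the complement can be reached over a barrier that is not higher
than the activation energy of the metastable state of the valley. -/
theorem exists_saddleEnergy_sub_le (hG : G.Connected) (hE : Function.Injective E)
    (hm : IsMetastableOrder G E m n) (hi : 1 ≤ i) (hin : i < n) (hx : x ∈ metastable m n i)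
    (hy : y ∈ metastable m n i) (hyx : y ≠ x) (u : S) :
    ∃ w, w ∉ valley G E m n i x ∧
      saddleEnergy G E u w - E u ≤ saddleEnergy G E x y - E x := by
  have hyV : y ∉ valley G E m n i x := fun h => hyx (eq_of_mem_valley hG hm hi hy h hx)
  obtain ⟨w, hw, hmin⟩ := Set.exists_min_image (valley G E m n i x)ᶜ
    (fun w => saddleEnergy G E u w) (Set.toFinite _) ⟨y, hyV⟩
  refine ⟨w, hw, ?_⟩
  by_contra! hlt
  have hxy := left_le_saddleEnergy (E := E) hG x y
  have hu : E u < saddleEnergy G E u w := by linarith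
  -- As `w` is the cheapest exit, the lake of `u` below that saddle lies in the valley. The
  -- contradiction comes from its bottom `m p`, which is either `x` itself or a state deleted before
  -- level `i`.
  have hLV : ∀ v, saddleEnergy G E u v < saddleEnergy G E u w → v ∈ valley G E m n i x := by
    intro v hv
    by_contra hvV
    exact hv.not_ge (hmin v hvV)
  obtain ⟨b, hbl, hub, hbmin⟩ := exists_bottom hG hE hu
  have hbu : E b ≤ E u := hbmin u (by rwa [saddleEnergy_self hG])
  have hout : ∀ z, saddleEnergy G E u w ≤ saddleEnergy G E u z →
      saddleEnergy G E u w ≤ saddleEnergy G E b z := fun z hz => by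
    by_contra! hbz
    exact hz.not_gt (saddleEnergy_trans_lt hG hub hbz)
  rw [← hm.range_eq] at hbl
  obtain ⟨p, hp, rfl⟩ := hbl
  rcases le_or_gt i p with hip | hpi
  · have hbx := eq_of_mem_valley hG hm hi ⟨p, ⟨hip, hp.2⟩, rfl⟩ (hLV _ hub) hx
    have := hout y (hmin y hyV)
    rw [hbx] at this hbu
    linarith
  · have hbM : m p ∈ metastable m n p := ⟨p, ⟨le_rfl, hp.2⟩, rfl⟩
    have h1 := activationEnergy_le_of_le hm hp.1 hpi.le hin hx
    have h2 := activationEnergy_le (G := G) (E := E) hy hyx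
    -- The closest competitor `z` of the bottom at level `p` shares its saddle, and `m p` has
    -- minimal activation energy, so `z` is lower than the bottom and hence outside the lake. The
    -- activation energy of `m p` is then at least the depth of the lake, too much for its early
    -- deletion.
    obtain ⟨z, hz, hzb, hact⟩ := exists_activationEnergy_eq (G := G) (E := E)
      (metastable_diff_nonempty hm hp.1 (by omega) (m p))
    have h3 := hm.minimal p hp.1 (by omega) z hz
    have h4 := activationEnergy_le (G := G) (E := E) hbM hzb.symm
    rw [saddleEnergy_comm hG] at h4
    have hzE : E z < E (m p) := lt_of_le_of_ne (by linarith) fun h => hzb (hE h)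
    have h5 := hout z (by by_contra! h; exact hzE.not_ge (hbmin z h))
    linarith

/-- The strict lake of `x` below the saddles to the other metastable states lies in the valley. -/
theorem mem_valley_of_saddleEnergy_lt (hG : G.Connected) (hm : IsMetastableOrder G E m n)
    (hi : 1 ≤ i) (hx : x ∈ metastable m n i)
    (hmin : ∀ y ∈ metastable m n i, y ≠ x → H ≤ saddleEnergy G E x y)
    (hv : saddleEnergy G E x v < H) : v ∈ valley G E m n i x :=
  mem_valley_of_attracted hG hm hi (attracted_of_mem_strictBasin hx
    (strictBasin_of_lt hG (self_mem_strictBasin hG (hm.subset hi) hx)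
      fun y hy hyx => hv.trans_le (hmin y hy hyx)))

/-- The outer boundary of a valley lies above the saddles to the other metastable states. -/
theorem le_of_mem_outerBoundary (hG : G.Connected) (hE : Function.Injective E)
    (hm : IsMetastableOrder G E m n) (hi : 1 ≤ i) (hx : x ∈ metastable m n i)
    (hmin : ∀ y ∈ metastable m n i, y ≠ x → H ≤ saddleEnergy G E x y)
    (ht : t ∈ outerBoundary G (valley G E m n i x)) : H ≤ E t := by
  obtain ⟨htV, r, hr, hrt⟩ := ht
  by_contra! htH
  -- If `r` is below `H`, then `r` and `t` share a lake, which either contains `x` or was absorbed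
  -- whole at an earlier level. Otherwise the step to `t` is downhill and attraction follows it.
  rcases lt_or_ge (E r) H with hrH | hrH
  · have hrt' : saddleEnergy G E r t < H :=
      (saddleEnergy_adj_le hG hrt (le_max_left _ _) (le_max_right _ _)).trans_lt (max_lt hrH htH)
    have hrx : H ≤ saddleEnergy G E r x := by
      by_contra! hrx
      rw [saddleEnergy_comm hG] at hrx
      exact htV (mem_valley_of_saddleEnergy_lt hG hm hi hx hmin
        (saddleEnergy_trans_lt hG hrx hrt'))
    obtain ⟨p, hp, hpi, hpn, hL⟩ := exists_lake_subset_valley hG hE hm hrH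
      fun y hy => hrx.trans (saddleEnergy_le_of_mem_valley hG hi hr y hy)
    exact htV (valley_subset_of_mem hG hm hp hpi.le ⟨p, ⟨le_rfl, hpn⟩, rfl⟩ hx
      (hL r (by rwa [saddleEnergy_self hG])) hr (hL t hrt'))
  · obtain ⟨k, a, hk, hki, hra, hsub⟩ := exists_attracted_of_mem_valley hi hr
    refine htV (hsub (mem_valley_of_attracted hG hm hk (hra.of_adj hG hrt ?_)))
    exact (htH.trans_le hrH).le.trans (left_le_saddleEnergy hG r a)

/-- A walk of minimal height from `x` to `y` must leave the valley. -/
theorem exists_mem_outerBoundary_le (hG : G.Connected)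
    (hm : IsMetastableOrder G E m n) (hi : 1 ≤ i) (hx : x ∈ metastable m n i)
    (hy : y ∈ metastable m n i) (hyx : y ≠ x) :
    ∃ t ∈ outerBoundary G (valley G E m n i x), E t ≤ saddleEnergy G E x y := by
  obtain ⟨a, b, ha, hb, hab, -, hQ⟩ := (linked_saddleEnergy (E := E) hG x y).exists_exit
    (valley G E m n i x) (self_mem_valley hG hm hi hx)
    fun h => hyx (eq_of_mem_valley hG hm hi hy h hx)
  exact ⟨b, ⟨hb, a, ha, hab⟩, hQ⟩

end Depth

/-! ### Potential theory of a finite reversible chain -/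

/-- A positive reversible chain with neighbourhood graph `G`. -/
structure IsReversibleChain {S : Type*} [Fintype S] (G : SimpleGraph S) (p : Matrix S S ℝ)
    (w : S → ℝ) : Prop where
  connected : G.Connected
  nonneg : ∀ r s, 0 ≤ p r s
  row_sum : ∀ r, ∑ s, p r s = 1
  pos : ∀ r s, G.Adj r s → 0 < p r s
  eq_zero : ∀ r s, r ≠ s → ¬ G.Adj r s → p r s = 0
  weight_pos : ∀ r, 0 < w r
  balance : ∀ r s, w r * p r s = w s * p s r

/-- The function `(1 - p) f`. -/
def defect {S : Type*} [Fintype S] (p : Matrix S S ℝ) (f : S → ℝ) (r : S) : ℝ :=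
  f r - ∑ s, p r s * f s

/-- The Green function of the chain killed outside `V`, as a function of the starting point. -/
structure IsGreen {S : Type*} [Fintype S] (p : Matrix S S ℝ) (V : Set S) (u : S) (g : S → ℝ) :
    Prop where
  self : defect p g u = 1
  off : ∀ r ∈ V, r ≠ u → defect p g r = 0
  zero : ∀ r ∉ V, g r = 0

section Chain

variable {S : Type*} [Fintype S] {G : SimpleGraph S} {p : Matrix S S ℝ} {w : S → ℝ}
  {U V : Set S} {f g φ : S → ℝ} {r s u v z : S}

theorem defect_add (f g : S → ℝ) (r : S) :
    defect p (fun s => f s + g s) r = defect p f r + defect p g r := by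
  simp only [defect, mul_add, Finset.sum_add_distrib]
  ring

theorem defect_smul (c : ℝ) (f : S → ℝ) (r : S) :
    defect p (fun s => c * f s) r = c * defect p f r := by
  simp only [defect, mul_sub, Finset.mul_sum, mul_left_comm]

theorem defect_sub (f g : S → ℝ) (r : S) :
    defect p (fun s => f s - g s) r = defect p f r - defect p g r := by
  simp only [defect, mul_sub, Finset.sum_sub_distrib]
  ring

theorem defect_sum {ι : Type*} (t : Finset ι) (f : ι → S → ℝ) (r : S) :
    defect p (fun s => ∑ i ∈ t, f i s) r = ∑ i ∈ t, defect p (f i) r := by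
  simp only [defect, Finset.sum_sub_distrib, Finset.mul_sum]
  rw [Finset.sum_comm]

namespace IsReversibleChain

theorem defect_eq (h : IsReversibleChain G p w) (f : S → ℝ) (r : S) :
    defect p f r = ∑ s, p r s * (f r - f s) := by
  simp only [defect, mul_sub, Finset.sum_sub_distrib, ← Finset.sum_mul, h.row_sum, one_mul]

theorem defect_const (h : IsReversibleChain G p w) (c : ℝ) (r : S) :
    defect p (fun _ => c) r = 0 := by simp [h.defect_eq]

/-- The comparison principle. -/
theorem nonneg_of_defect_nonneg (h : IsReversibleChain G p w) (hz : z ∉ U)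
    (hf : ∀ r ∈ U, 0 ≤ defect p f r) (hb : ∀ r ∈ U, ∀ s, s ∉ U → G.Adj r s → 0 ≤ f s) :
    ∀ r ∈ U, 0 ≤ f r := by
  by_contra! hcon
  obtain ⟨r₀, hr₀, hneg⟩ := hcon
  obtain ⟨r, hr, hmin⟩ := Set.exists_min_image U f (Set.toFinite _) ⟨r₀, hr₀⟩
  have hrneg : f r < 0 := (hmin r₀ hr₀).trans_lt hneg
  obtain ⟨walk⟩ := h.connected.preconnected r z
  have hl : Linked G (fun _ => True) r z := ⟨walk, fun _ _ => trivial⟩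
  -- A negative minimum propagates to all neighbours and cannot meet the nonnegative boundary
  -- values, so by connectedness it would reach `z ∉ U`.
  refine hz (hl.spread (R := fun v => v ∈ U ∧ f v = f r) ⟨hr, rfl⟩ ?_).1
  rintro a b ⟨haU, haf⟩ hab -
  have hterm : ∀ s, p a s * (f a - f s) ≤ 0 := by
    intro s
    by_cases hs : s = a
    · simp [hs]
    by_cases has : G.Adj a s
    · refine mul_nonpos_of_nonneg_of_nonpos (h.nonneg a s) ?_
      rw [haf]
      by_cases hsU : s ∈ U
      · linarith [hmin s hsU]
      · linarith [hb a haU s hsU has]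
    · simp [h.eq_zero a s (Ne.symm hs) has]
  have hsum := hf a haU
  rw [h.defect_eq] at hsum
  have hzero := (Finset.sum_eq_zero_iff_of_nonpos fun s _ => hterm s).1
    (le_antisymm (Finset.sum_nonpos fun s _ => hterm s) hsum) b (Finset.mem_univ b)
  have hfb : f b = f r := by
    rcases mul_eq_zero.1 hzero with h0 | h0
    · exact absurd h0 (h.pos a b hab).ne'
    · linarith
  refine ⟨?_, hfb⟩
  by_contra hbU
  linarith [hb a haU b hbU hab]

theorem le_of_defect_le (h : IsReversibleChain G p w) (hz : z ∉ U)
    (hfg : ∀ r ∈ U, defect p f r ≤ defect p g r)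
    (hb : ∀ r ∈ U, ∀ s, s ∉ U → G.Adj r s → f s ≤ g s) : ∀ r ∈ U, f r ≤ g r := fun r hr =>
  sub_nonneg.1 (h.nonneg_of_defect_nonneg (f := fun s => g s - f s) hz
    (fun r hr => by rw [defect_sub]; linarith [hfg r hr])
    (fun r hr s hs hrs => sub_nonneg.2 (hb r hr s hs hrs)) r hr)

/-- The Dirichlet problem is solvable. -/
theorem exists_defect_eq (h : IsReversibleChain G p w) (hz : z ∉ U) (b : S → ℝ) :
    ∃ f : S → ℝ, (∀ r ∈ U, defect p f r = b r) ∧ ∀ r ∉ U, f r = b r := by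
  classical
  let T : (S → ℝ) →ₗ[ℝ] (S → ℝ) :=
    { toFun := fun f r => if r ∈ U then defect p f r else f r
      map_add' := fun f g => by
        ext r
        by_cases hr : r ∈ U
        · simpa [hr] using! defect_add f g r
        · simp [hr]
      map_smul' := fun c f => by
        ext r
        by_cases hr : r ∈ U
        · simpa [hr] using! defect_smul c f r
        · simp [hr] }
  have hT : ∀ f r, T f r = if r ∈ U then defect p f r else f r := fun _ _ => rfl
  -- In finite dimension uniqueness, which is the comparison principle, gives existence.
  have hinj : Function.Injective T := by
    rw [← LinearMap.ker_eq_bot, LinearMap.ker_eq_bot']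
    intro f hf
    have hU : ∀ r ∈ U, defect p f r = 0 := fun r hr => by
      have := congrFun hf r
      rwa [hT, if_pos hr] at this
    have hUc : ∀ r ∉ U, f r = 0 := fun r hr => by
      have := congrFun hf r
      rwa [hT, if_neg hr] at this
    have h0 : ∀ r ∈ U, defect p (fun _ => 0) r = 0 := fun r _ => h.defect_const 0 r
    ext r
    by_cases hr : r ∈ U
    · refine le_antisymm ?_ ?_
      · exact h.le_of_defect_le (g := fun _ => 0) hz (fun r hr => by rw [hU r hr, h0 r hr])
          (fun _ _ s hs _ => (hUc s hs).le) r hr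
      · exact h.le_of_defect_le (f := fun _ => 0) hz (fun r hr => by rw [hU r hr, h0 r hr])
          (fun _ _ s hs _ => (hUc s hs).ge) r hr
    · exact hUc r hr
  obtain ⟨f, hf⟩ := LinearMap.injective_iff_surjective.1 hinj b
  refine ⟨f, fun r hr => ?_, fun r hr => ?_⟩
  · rw [← hf, hT, if_pos hr]
  · rw [← hf, hT, if_neg hr]

theorem exists_green (h : IsReversibleChain G p w) (hz : z ∉ V) (hu : u ∈ V) :
    ∃ g, IsGreen p V u g := by
  classical
  obtain ⟨g, hg, hg'⟩ := h.exists_defect_eq hz fun r => if r = u then 1 else 0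
  refine ⟨g, by simpa using hg u hu, fun r hr hru => by simpa [hru] using hg r hr, fun r hr => ?_⟩
  have hru : r ≠ u := by rintro rfl; exact hr hu
  simpa [hru] using hg' r hr

open Classical in
/-- The net flow out of a set. -/
theorem sum_weight_defect (h : IsReversibleChain G p w) (W : Finset S) (g : S → ℝ) :
    ∑ r ∈ W, w r * defect p g r = ∑ r ∈ W, ∑ s ∈ Wᶜ, w r * p r s * (g r - g s) := by
  have h1 : ∀ r, w r * defect p g r = ∑ s ∈ W, w r * p r s * (g r - g s) +
      ∑ s ∈ Wᶜ, w r * p r s * (g r - g s) := fun r => by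
    rw [Finset.sum_add_sum_compl, h.defect_eq, Finset.mul_sum]
    simp only [mul_assoc]
  -- The flow is antisymmetric by reversibility, so internal edges cancel.
  have h2 : ∑ r ∈ W, ∑ s ∈ W, w r * p r s * (g r - g s) = 0 := by
    have h3 : ∑ r ∈ W, ∑ s ∈ W, w r * p r s * (g r - g s) =
        -∑ r ∈ W, ∑ s ∈ W, w r * p r s * (g r - g s) := by
      conv_lhs => rw [Finset.sum_comm]
      rw [← Finset.sum_neg_distrib]
      refine Finset.sum_congr rfl fun r _ => ?_
      rw [← Finset.sum_neg_distrib]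
      refine Finset.sum_congr rfl fun s _ => ?_
      rw [h.balance s r]
      ring
    linarith
  rw [Finset.sum_congr rfl fun r _ => h1 r, Finset.sum_add_distrib, h2, zero_add]

/-- Detailed balance makes `1 - p` self-adjoint with respect to the weights `w`. -/
theorem sum_weight_mul_defect_comm (h : IsReversibleChain G p w) (f g : S → ℝ) :
    ∑ r, w r * (f r * defect p g r) = ∑ r, w r * (g r * defect p f r) := by
  simp only [defect, mul_sub, Finset.sum_sub_distrib, Finset.mul_sum]
  congr 1
  · exact Finset.sum_congr rfl fun r _ => by ring
  · rw [Finset.sum_comm]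
    refine Finset.sum_congr rfl fun r _ => Finset.sum_congr rfl fun s _ => ?_
    linear_combination f s * g r * h.balance s r

end IsReversibleChain

namespace IsGreen

theorem mem (h : IsReversibleChain G p w) (hg : IsGreen p V u g) (hgz : ∀ s, 0 ≤ g s) : u ∈ V := by
  by_contra hu
  have h1 := hg.self
  rw [defect, hg.zero u hu] at h1
  have := Finset.sum_nonneg fun s (_ : s ∈ Finset.univ) => mul_nonneg (h.nonneg u s) (hgz s)
  linarith

theorem defect_nonneg (hg : IsGreen p V u g) (hr : r ∈ V) : 0 ≤ defect p g r := by
  by_cases hru : r = u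
  · rw [hru, hg.self]
    exact zero_le_one
  · rw [hg.off r hr hru]

theorem defect_le_one (hg : IsGreen p V u g) (hr : r ∈ V) : defect p g r ≤ 1 := by
  by_cases hru : r = u
  · rw [hru, hg.self]
  · rw [hg.off r hr hru]
    exact zero_le_one

theorem nonneg (h : IsReversibleChain G p w) (hz : z ∉ V) (hg : IsGreen p V u g) (r : S) :
    0 ≤ g r := by
  by_cases hr : r ∈ V
  · exact h.nonneg_of_defect_nonneg hz (fun r hr => hg.defect_nonneg hr)
      (fun _ _ s hs _ => (hg.zero s hs).ge) r hr
  · exact (hg.zero r hr).ge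

/-- Maximum principle on `V \ {u}`, where `g` is harmonic with boundary values at most `g u`. -/
theorem le_self (h : IsReversibleChain G p w) (hz : z ∉ V) (hg : IsGreen p V u g) (r : S) :
    g r ≤ g u := by
  have hn := hg.nonneg h hz
  by_cases hr : r ∈ V \ {u}
  · refine h.le_of_defect_le (U := V \ {u}) (g := fun _ => g u) (fun h => hz h.1) ?_ ?_ r hr
    · exact fun r hr => by rw [h.defect_const, hg.off r hr.1 hr.2]
    · intro _ _ s hs _
      by_cases hsV : s ∈ V
      · rw [show s = u by by_contra hsu; exact hs ⟨hsV, hsu⟩]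
      · rw [hg.zero s hsV]
        exact hn u
  · by_cases hrV : r ∈ V
    · rw [show r = u by by_contra hru; exact hr ⟨hrV, hru⟩]
    · rw [hg.zero r hrV]
      exact hn u

theorem sum_weight_defect_eq (hg : IsGreen p V u g) (W : Finset S) (hu : u ∈ W)
    (hWV : ∀ v ∈ W, v ∈ V) : ∑ r ∈ W, w r * defect p g r = w u := by
  rw [Finset.sum_eq_single_of_mem u hu, hg.self, mul_one]
  intro r hr hru
  rw [hg.off r (hWV r hr) hru, mul_zero]

/-- The flow through every edge is at most the total flow. -/
theorem weight_mul_sub_le (h : IsReversibleChain G p w) (hz : z ∉ V) (hg : IsGreen p V u g)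
    (r s : S) : w r * p r s * (g r - g s) ≤ w u := by
  classical
  have hn := hg.nonneg h hz
  rcases le_or_gt (g r) (g s) with hrs | hrs
  · exact (mul_nonpos_of_nonneg_of_nonpos (mul_nonneg (h.weight_pos r).le (h.nonneg r s))
      (by linarith)).trans (h.weight_pos u).le
  -- Across the boundary of a superlevel set all flows are nonnegative, and they add up to `w u`, so
  -- none exceeds it.
  let W : Finset S := Finset.univ.filter fun v => g s < g v
  have hW : ∀ v, v ∈ W ↔ g s < g v := fun v => by simp [W]
  have hsum := h.sum_weight_defect W g
  rw [hg.sum_weight_defect_eq W ((hW u).2 (hrs.trans_le (hg.le_self h hz r)))] at hsum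
  · have hterm : ∀ a ∈ W, ∀ b ∈ Wᶜ, 0 ≤ w a * p a b * (g a - g b) := by
      intro a ha b hb
      rw [hW] at ha
      rw [Finset.mem_compl, hW, not_lt] at hb
      exact mul_nonneg (mul_nonneg (h.weight_pos a).le (h.nonneg a b)) (by linarith)
    rw [hsum]
    have hr : r ∈ W := (hW r).2 hrs
    have hs : s ∈ Wᶜ := by simp [hW]
    exact (Finset.single_le_sum (f := fun b => w r * p r b * (g r - g b))
      (fun b hb => hterm r hr b hb) hs).trans
      (Finset.single_le_sum (f := fun a => ∑ b ∈ Wᶜ, w a * p a b * (g a - g b))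
      (fun a ha => Finset.sum_nonneg fun b hb => hterm a ha b hb) hr)
  · intro v hv
    by_contra hvV
    rw [hW, hg.zero v hvV] at hv
    exact (hn s).not_gt hv

end IsGreen

theorem sum_sum_le_card_sq_mul {F : S → S → ℝ} {c : ℝ} (W T : Finset S) (hc : 0 ≤ c)
    (hF : ∀ a ∈ W, ∀ b ∈ T, F a b ≤ c) :
    ∑ a ∈ W, ∑ b ∈ T, F a b ≤ Fintype.card S ^ 2 * c := by
  have h1 : ∀ A : Finset S, (A.card : ℝ) ≤ Fintype.card S := fun A => by
    exact_mod_cast Finset.card_le_univ A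
  refine (Finset.sum_le_card_nsmul W _ (Fintype.card S * c) fun a ha => ?_).trans ?_
  · refine (Finset.sum_le_card_nsmul T _ c (hF a ha)).trans ?_
    rw [nsmul_eq_mul]
    exact mul_le_mul_of_nonneg_right (h1 T) hc
  · rw [nsmul_eq_mul, sq, mul_assoc]
    exact mul_le_mul_of_nonneg_right (h1 W) (mul_nonneg (Nat.cast_nonneg _) hc)

/-- A function with small increments along the edges of a walk has a small total increment. -/
theorem Linked.sub_le {Q : S → Prop} {B : ℝ} (hB : 0 ≤ B) (hl : Linked G Q r s)
    (hg : ∀ a b, G.Adj a b → Q a → Q b → g a - g b ≤ B) :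
    g r - g s ≤ Fintype.card S * B := by
  classical
  obtain ⟨walk, hw⟩ := hl
  have key : ∀ {a b : S} (q : G.Walk a b), (∀ v ∈ q.support, Q v) → g a - g b ≤ q.length * B := by
    intro a b q hq
    induction q with
    | nil => simp
    | @cons a b c hab q ih =>
      have h1 := ih fun v hv => hq v (by simp [hv])
      have h2 := hg a b hab (hq a (by simp)) (hq b (by simp))
      rw [SimpleGraph.Walk.length_cons]
      push_cast
      linarith
  refine (key walk.bypass fun v hv => hw v (walk.support_bypass_subset_support hv)).trans ?_
  refine mul_le_mul_of_nonneg_right ?_ hB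
  exact_mod_cast walk.bypass_isPath.length_lt.le

namespace IsGreen

/-- Upper bound for the Green function through a walk of edges of high conductance. -/
theorem self_le (h : IsReversibleChain G p w) (hz : z ∉ V) (hg : IsGreen p V u g)
    {Q : S → Prop} {κ : ℝ} (hκ : 0 < κ) (hl : Linked G Q u z)
    (hQ : ∀ a b, G.Adj a b → Q a → Q b → w u * κ ≤ w a * p a b) :
    g u ≤ Fintype.card S * κ⁻¹ := by
  have hB := hl.sub_le (g := g) (inv_nonneg.2 hκ.le) fun a b hab ha hb => ?_
  · rwa [hg.zero z hz, sub_zero] at hB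
  · rcases le_or_gt (g a - g b) 0 with h0 | h0
    · exact h0.trans (inv_nonneg.2 hκ.le)
    · have h1 := hg.weight_mul_sub_le h hz a b
      have h2 := mul_le_mul_of_nonneg_right (hQ a b hab ha hb) h0.le
      have h3 := h.weight_pos u
      rw [← mul_le_mul_iff_right₀ (mul_pos h3 hκ), mul_assoc (w u) κ κ⁻¹, mul_inv_cancel₀ hκ.ne',
        mul_one]
      exact h2.trans h1

/-- Lower bound for the Green function through a cut of edges of low conductance. -/
theorem one_le_self_mul (h : IsReversibleChain G p w) (hz : z ∉ V) (hg : IsGreen p V u g)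
    {κ : ℝ} (W : Finset S) (hu : u ∈ W) (hWV : ∀ v ∈ W, v ∈ V) (hκ0 : 0 ≤ κ)
    (hκ : ∀ a ∈ W, ∀ b ∉ W, w a * p a b ≤ w u * κ) :
    1 ≤ Fintype.card S ^ 2 * κ * g u := by
  classical
  have hn := hg.nonneg h hz
  have hw := h.weight_pos u
  have hsum := h.sum_weight_defect W g
  rw [hg.sum_weight_defect_eq W hu hWV] at hsum
  have hle : ∑ r ∈ W, ∑ s ∈ Wᶜ, w r * p r s * (g r - g s) ≤
      Fintype.card S ^ 2 * (w u * κ * g u) := by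
    refine sum_sum_le_card_sq_mul W Wᶜ (mul_nonneg (mul_nonneg hw.le hκ0) (hn u)) ?_
    intro a ha b hb
    have h1 := hg.le_self h hz a
    have h2 := hn b
    exact (mul_le_mul_of_nonneg_left (by linarith)
      (mul_nonneg (h.weight_pos a).le (h.nonneg a b))).trans
      (mul_le_mul_of_nonneg_right (hκ a ha b (Finset.mem_compl.1 hb)) (hn u))
  rw [← hsum] at hle
  rw [← mul_le_mul_iff_right₀ hw]
  linarith

/-- A function that is harmonic on `W \ T`, zero on `T` and one outside `W` is small at states from
which `T` is reached more easily than the complement of `W`. -/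
theorem harmonic_le (h : IsReversibleChain G p w) {W T : Set S} (hz : z ∉ W \ T)
    (hg : IsGreen p (W \ T) r g) (hφ : ∀ a ∈ W \ T, defect p φ a = 0) (hφT : ∀ a ∈ T, φ a = 0)
    (hφW : ∀ a ∉ W, φ a = 1) {κ : ℝ} (hκ0 : 0 ≤ κ)
    (hκ : ∀ a ∈ W, ∀ b ∉ W, w a * p a b ≤ w r * κ) :
    φ r ≤ Fintype.card S ^ 2 * κ * g r := by
  classical
  have hn := hg.nonneg h hz
  have hw := h.weight_pos r
  have hr : r ∈ W \ T := hg.mem h hn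
  have hC : 0 ≤ w r * κ * g r := mul_nonneg (mul_nonneg hw.le hκ0) (hn r)
  -- Green's identity: the side with `defect p φ` vanishes, and the other one leaves `w r * φ r`
  -- minus the flow of `g` out of `W`.
  have hsum := h.sum_weight_mul_defect_comm φ g
  have h0 : ∀ a, w a * (g a * defect p φ a) = 0 := fun a => by
    by_cases ha : a ∈ W \ T
    · rw [hφ a ha, mul_zero, mul_zero]
    · rw [hg.zero a ha, zero_mul, mul_zero]
  rw [Finset.sum_eq_zero fun a _ => h0 a] at hsum
  have hterm : ∀ a, (if a = r then w r * φ r else 0) - Fintype.card S * (w r * κ * g r) ≤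
      w a * (φ a * defect p g a) := by
    intro a
    have hC' : 0 ≤ Fintype.card S * (w r * κ * g r) := mul_nonneg (Nat.cast_nonneg _) hC
    by_cases har : a = r
    · rw [if_pos har, har, hg.self, mul_one]
      linarith
    rw [if_neg har]
    by_cases haV : a ∈ W \ T
    · rw [hg.off a haV har, mul_zero, mul_zero]
      linarith
    by_cases haW : a ∈ W
    · have haT : a ∈ T := by by_contra haT; exact haV ⟨haW, haT⟩
      rw [hφT a haT, zero_mul, mul_zero]
      linarith
    · have h1 : ∑ b, w a * (p a b * g b) ≤ Fintype.card S * (w r * κ * g r) := by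
        refine (Finset.sum_le_card_nsmul _ _ (w r * κ * g r) fun b _ => ?_).trans_eq (by simp)
        by_cases hb : b ∈ W \ T
        · rw [← mul_assoc, h.balance a b]
          exact mul_le_mul (hκ b hb.1 a haW) (hg.le_self h hz b) (hn b) (mul_nonneg hw.le hκ0)
        · rw [hg.zero b hb, mul_zero, mul_zero]
          exact hC
      rw [hφW a haW, one_mul, defect, hg.zero a haV, mul_sub, mul_zero, Finset.mul_sum]
      linarith
  have hle := Finset.sum_le_sum fun a (_ : a ∈ Finset.univ) => hterm a
  rw [hsum, Finset.sum_sub_distrib, Finset.sum_ite_eq' Finset.univ r, Finset.sum_const,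
    Finset.card_univ, nsmul_eq_mul, if_pos (Finset.mem_univ r)] at hle
  rw [← mul_le_mul_iff_right₀ hw]
  linarith

end IsGreen

namespace IsReversibleChain

/-- A solution of the exit time equation lies above the Green functions. -/
theorem green_le (h : IsReversibleChain G p w) (hz : z ∉ V) (hg : IsGreen p V u g)
    (hf : ∀ r ∈ V, defect p f r = 1) (hf0 : ∀ r ∉ V, f r = 0) (r : S) : g r ≤ f r := by
  by_cases hr : r ∈ V
  · exact h.le_of_defect_le hz (fun r hr => (hg.defect_le_one hr).trans_eq (hf r hr).symm)
      (fun _ _ s hs _ => by rw [hg.zero s hs, hf0 s hs]) r hr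
  · rw [hg.zero r hr, hf0 r hr]

/-- A solution of the exit time equation is bounded through the Green functions. -/
theorem le_of_green_le (h : IsReversibleChain G p w) (hz : z ∉ V)
    (hf : ∀ r ∈ V, defect p f r = 1) (hf0 : ∀ r ∉ V, f r = 0) {C : ℝ} (hC : 0 ≤ C)
    (hgC : ∀ u ∈ V, ∀ g, IsGreen p V u g → g u ≤ C) (r : S) : f r ≤ Fintype.card S * C := by
  classical
  have hex : ∀ u, ∃ g, u ∈ V → IsGreen p V u g := fun u => by
    by_cases hu : u ∈ V
    · obtain ⟨g, hg⟩ := h.exists_green hz hu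
      exact ⟨g, fun _ => hg⟩
    · exact ⟨0, fun h => absurd h hu⟩
  choose g hg using hex
  by_cases hr : r ∈ V
  · have hle := h.le_of_defect_le (f := f)
      (g := fun s => ∑ u ∈ Finset.univ.filter (· ∈ V), g u s) hz ?_ ?_ r hr
    · refine hle.trans ((Finset.sum_le_card_nsmul _ _ C fun u hu => ?_).trans ?_)
      · have hu : u ∈ V := by simpa using hu
        exact ((hg u hu).le_self h hz r).trans (hgC u hu _ (hg u hu))
      · rw [nsmul_eq_mul]
        exact mul_le_mul_of_nonneg_right (by exact_mod_cast Finset.card_le_univ _) hC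
    · intro s hs
      rw [hf s hs, defect_sum]
      rw [← (hg s hs).self]
      exact Finset.single_le_sum (f := fun u => defect p (g u) s) (fun u hu =>
        (hg u (by simpa using hu)).defect_nonneg hs) (by simpa using hs)
    · intro _ _ s hs _
      rw [hf0 s hs]
      exact Finset.sum_nonneg fun u hu => ((hg u (by simpa using hu)).nonneg h hz s)
  · rw [hf0 r hr]
    exact mul_nonneg (Nat.cast_nonneg _) hC

end IsReversibleChain

end Chain

/-! ### Expected exit times -/

section ExitTime

variable {S Ω : Type*} {X : ℕ → Ω → S} {N : Set S} {ω : Ω}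

theorem lt_firstTime_iff (k : ℕ) : (k : ℕ∞) < firstTime X N 0 ω ↔ ∀ l ≤ k, X l ω ∉ N := by
  rw [← ENat.add_one_le_iff (ENat.natCast_ne_top k), firstTime]
  simp only [le_iInf_iff, and_imp]
  constructor
  · intro h l hl hN
    have := h l (by simp) hN
    have : k + 1 ≤ l := by exact_mod_cast this
    omega
  · intro h l _ hN
    have : k + 1 ≤ l := by
      by_contra! hl
      exact h l (by omega) hN
    exact_mod_cast this

theorem exitTime_eq_firstTime (h : X 0 ω ∉ N) : exitTime X N ω = firstTime X N 0 ω := by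
  have h0 : entranceTime X N ω = 0 :=
    nonpos_iff_eq_zero.1 (iInf₂_le_of_le 0 ⟨le_rfl, h⟩ le_rfl)
  rw [exitTime, h0]

theorem toENNReal_eq_tsum (τ : ℕ∞) :
    (τ : ℝ≥0∞) = ∑' k : ℕ, if (k : ℕ∞) < τ then (1 : ℝ≥0∞) else 0 := by
  induction τ using ENat.recTopCoe with
  | top => simp
  | coe t =>
    rw [tsum_eq_sum (s := Finset.range t) fun k hk => ?_]
    · rw [Finset.sum_congr rfl fun k hk => ?_, Finset.sum_const, Finset.card_range, nsmul_eq_mul,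
        mul_one]
      · simp
      · rw [if_pos]
        exact_mod_cast Finset.mem_range.1 hk
    · rw [if_neg]
      have : t ≤ k := by simpa using hk
      exact not_lt.2 (by exact_mod_cast this)

/-- The probability that the chain has avoided `N` up to time `k` and is at `s` at time `k`. -/
def avoidProb [MeasurableSpace Ω] (μ : Measure Ω) (X : ℕ → Ω → S) (N : Set S) (k : ℕ) (s : S) : ℝ≥0∞ :=
  μ {ω | (∀ l ≤ k, X l ω ∉ N) ∧ X k ω = s}

theorem avoidProb_of_mem [MeasurableSpace Ω] {μ : Measure Ω} (k : ℕ) {s : S} (hs : s ∈ N) : avoidProb μ X N k s = 0 := by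
  rw [avoidProb]
  convert measure_empty (μ := μ)
  ext ω
  simp only [Set.mem_ofPred_eq, Set.mem_empty_iff_false, iff_false, not_and]
  rintro h rfl
  exact h k le_rfl hs

namespace IsMarkovChain

theorem avoidProb_zero_self [MeasurableSpace Ω] {μ : Measure Ω}
    {p : Matrix S S ℝ} {r : S} (h : IsMarkovChain μ X p r) (hr : r ∉ N) :
    avoidProb μ X N 0 r = 1 := by
  have := h.prob
  refine (measure_congr (t := Set.univ) ?_).trans measure_univ
  filter_upwards [h.start] with ω hω
  refine propext ⟨fun _ => trivial, fun _ => ⟨fun l hl => ?_, hω⟩⟩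
  obtain rfl : l = 0 := by omega
  rwa [hω]

theorem avoidProb_zero_of_ne [MeasurableSpace Ω] {μ : Measure Ω}
    {p : Matrix S S ℝ} {r s : S} (h : IsMarkovChain μ X p r) (hs : s ≠ r) :
    avoidProb μ X N 0 s = 0 := by
  refine (measure_congr (t := ∅) ?_).trans measure_empty
  filter_upwards [h.start] with ω hω
  exact propext ⟨fun h => hs (h.2.symm.trans hω), fun h => h.elim⟩

end IsMarkovChain

variable [Fintype S] [MeasurableSpace Ω] {μ : Measure Ω} {p : Matrix S S ℝ} {r : S}

namespace IsMarkovChain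

theorem measurable_history (h : IsMarkovChain μ X p r) (k : ℕ) (A : Set (Fin (k + 1) → S)) :
    MeasurableSet {ω | (fun l : Fin (k + 1) => X l ω) ∈ A} := by
  let _ : MeasurableSpace S := ⊤
  have hX : ∀ n, Measurable (X n) := fun n => measurable_to_countable' fun s => h.measurable n s
  have hY : Measurable fun ω => (fun l : Fin (k + 1) => X l ω) :=
    measurable_pi_lambda _ fun l => hX l
  exact hY (Set.toFinite A).measurableSet

theorem measurable_avoid (h : IsMarkovChain μ X p r) (k : ℕ) :
    MeasurableSet {ω | ∀ l ≤ k, X l ω ∉ N} := by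
  convert h.measurable_history k {y | ∀ l, y l ∉ N} using 1
  ext ω
  simp only [Set.mem_ofPred_eq]
  exact ⟨fun h l => h l (by omega), fun h l hl => h ⟨l, by omega⟩⟩

/-- The Markov property for a set of histories. -/
theorem measure_history (h : IsMarkovChain μ X p r) (k : ℕ) (A : Set (Fin (k + 1) → S)) (u s : S)
    (hA : ∀ y ∈ A, y (Fin.last k) = u) :
    μ ({ω | (fun l : Fin (k + 1) => X l ω) ∈ A} ∩ {ω | X (k + 1) ω = s}) =
      μ {ω | (fun l : Fin (k + 1) => X l ω) ∈ A} * ENNReal.ofReal (p u s) := by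
  classical
  let Y : Ω → Fin (k + 1) → S := fun ω l => X l ω
  have hY : ∀ y, MeasurableSet (Y ⁻¹' {y}) := fun y => h.measurable_history k {y}
  let A' : Finset (Fin (k + 1) → S) := A.toFinset
  have hA' : {ω | (fun l : Fin (k + 1) => X l ω) ∈ A} = Y ⁻¹' A' := by
    ext ω
    simp [A', Y]
  have h1 := sum_measure_preimage_singleton (μ := μ) A' fun y _ => hY y
  have h2 := sum_measure_preimage_singleton (μ := μ.restrict {ω | X (k + 1) ω = s}) A'
    fun y _ => hY y
  rw [hA', ← Measure.restrict_apply' (h.measurable _ s), ← h1, ← h2, Finset.sum_mul]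
  refine Finset.sum_congr rfl fun y hy => ?_
  have hyu : y (Fin.last k) = u := hA y (by simpa [A'] using hy)
  -- The truncation `min l k` extends a finite history to all times, as the Markov property
  -- requires; values after time `k` play no role.
  have hset : Y ⁻¹' {y} = {ω | ∀ l ≤ k, X l ω = y ⟨min l k, by omega⟩} := by
    ext ω
    simp only [Set.mem_preimage, Set.mem_singleton_iff, Set.mem_ofPred_eq, funext_iff, Y]
    constructor
    · intro h l hl
      rw [← h]
      simp [hl]
    · intro h l
      rw [h l (by omega)]
      congr 1
      ext
      simp
      omega
  have hM := h.markov k (fun l => y ⟨min l k, by omega⟩) s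
  rw [Measure.restrict_apply' (h.measurable _ s), hset]
  refine Eq.trans ?_ (hM.trans ?_)
  · rfl
  · congr 3
    rw [← hyu]
    congr 1
    ext
    simp

theorem avoidProb_succ (h : IsMarkovChain μ X p r) (k : ℕ) {s : S} (hs : s ∉ N) :
    avoidProb μ X N (k + 1) s = ∑ u, avoidProb μ X N k u * ENNReal.ofReal (p u s) := by
  have hset : {ω | (∀ l ≤ k + 1, X l ω ∉ N) ∧ X (k + 1) ω = s} =
      {ω | ∀ l ≤ k, X l ω ∉ N} ∩ {ω | X (k + 1) ω = s} := by
    ext ω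
    simp only [Set.mem_ofPred_eq, Set.mem_inter_iff]
    constructor
    · exact fun h => ⟨fun l hl => h.1 l (by omega), h.2⟩
    · rintro ⟨h1, h2⟩
      refine ⟨fun l hl => ?_, h2⟩
      rcases Nat.le_succ_iff.1 hl with hl | rfl
      · exact h1 l hl
      · rwa [h2]
  have hmeas := (h.measurable_avoid (N := N) k).inter (h.measurable (k + 1) s)
  have hsum := sum_measure_preimage_singleton
    (μ := μ.restrict ({ω | ∀ l ≤ k, X l ω ∉ N} ∩ {ω | X (k + 1) ω = s}))
    (Finset.univ : Finset S) (f := X k) fun u _ => h.measurable k u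
  rw [Finset.coe_univ, Set.preimage_univ, Measure.restrict_apply_univ] at hsum
  rw [avoidProb, hset, ← hsum]
  refine Finset.sum_congr rfl fun u _ => ?_
  have h1 := h.measure_history k {y | (∀ l, y l ∉ N) ∧ y (Fin.last k) = u} u s fun y hy => hy.2
  have h2 : {ω | (fun l : Fin (k + 1) => X l ω) ∈
      {y : Fin (k + 1) → S | (∀ l, y l ∉ N) ∧ y (Fin.last k) = u}} =
      {ω | (∀ l ≤ k, X l ω ∉ N) ∧ X k ω = u} := by
    ext ω
    simp only [Set.mem_ofPred_eq, Fin.val_last]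
    refine and_congr_left fun _ => ?_
    exact ⟨fun h l hl => h ⟨l, by omega⟩, fun h l => h l (by omega)⟩
  rw [h2] at h1
  rw [avoidProb, ← h1, Measure.restrict_apply' hmeas]
  congr 1
  ext ω
  simp only [Set.mem_preimage, Set.mem_singleton_iff, Set.mem_ofPred_eq, Set.mem_inter_iff]
  tauto

theorem measure_avoid (h : IsMarkovChain μ X p r) (k : ℕ) :
    μ {ω | ∀ l ≤ k, X l ω ∉ N} = ∑ s, avoidProb μ X N k s := by
  have hsum := sum_measure_preimage_singleton (μ := μ.restrict {ω | ∀ l ≤ k, X l ω ∉ N})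
    (Finset.univ : Finset S) (f := X k) fun u _ => h.measurable k u
  rw [Finset.coe_univ, Set.preimage_univ, Measure.restrict_apply_univ] at hsum
  rw [← hsum]
  refine Finset.sum_congr rfl fun s _ => ?_
  rw [Measure.restrict_apply' (h.measurable_avoid k), avoidProb]
  congr 1
  ext ω
  simp only [Set.mem_preimage, Set.mem_singleton_iff, Set.mem_ofPred_eq, Set.mem_inter_iff]
  tauto

/-- The expected exit time, for a start outside `N`, as a sum of survival probabilities. -/
theorem expectedTime_eq_tsum (h : IsMarkovChain μ X p r) (hr : r ∉ N) :
    expectedTime μ (exitTime X N) = ∑' k, ∑ s, avoidProb μ X N k s := by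
  have h1 : ∀ᵐ ω ∂μ, ((exitTime X N ω : ℕ∞) : ℝ≥0∞) =
      ∑' k : ℕ, {ω | ∀ l ≤ k, X l ω ∉ N}.indicator 1 ω := by
    filter_upwards [h.start] with ω hω
    rw [exitTime_eq_firstTime (by rwa [hω]), toENNReal_eq_tsum]
    refine tsum_congr fun k => ?_
    by_cases hk : ∀ l ≤ k, X l ω ∉ N
    · rw [if_pos ((lt_firstTime_iff k).2 hk), Set.indicator_of_mem (by exact hk), Pi.one_apply]
    · rw [if_neg (mt (lt_firstTime_iff k).1 hk), Set.indicator_of_notMem (by exact hk)]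
  rw [expectedTime, lintegral_congr_ae h1, lintegral_tsum fun k =>
    (measurable_one.indicator (h.measurable_avoid k)).aemeasurable]
  refine tsum_congr fun k => ?_
  rw [lintegral_indicator_one (h.measurable_avoid k), h.measure_avoid]

/-- The expected exit time solves a linear equation. -/
theorem expectedTime_eq (h : IsMarkovChain μ X p r) (hr : r ∉ N) (hp : ∀ s u, 0 ≤ p s u)
    {f : S → ℝ} (hf0 : ∀ s, 0 ≤ f s) (hfN : ∀ s ∈ N, f s = 0)
    (hf : ∀ s ∉ N, defect p f s = 1) :
    expectedTime μ (exitTime X N) = ENNReal.ofReal (f r) := by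
  classical
  have := h.prob
  let c : ℕ → S → ℝ := fun k s => (avoidProb μ X N k s).toReal
  have hfin : ∀ k s, avoidProb μ X N k s ≠ ⊤ := fun k s => measure_ne_top μ _
  have hc0 : ∀ k s, 0 ≤ c k s := fun k s => ENNReal.toReal_nonneg
  have hcN : ∀ k, ∀ s ∈ N, c k s = 0 := fun k s hs => by simp [c, avoidProb_of_mem k hs]
  have hcsucc : ∀ k, ∀ s ∉ N, c (k + 1) s = ∑ u, c k u * p u s := fun k s hs => by
    simp only [c]
    rw [h.avoidProb_succ k hs, ENNReal.toReal_sum fun u _ =>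
      ENNReal.mul_ne_top (hfin k u) ENNReal.ofReal_ne_top]
    refine Finset.sum_congr rfl fun u _ => ?_
    rw [ENNReal.toReal_mul, ENNReal.toReal_ofReal (hp u s)]
  have hczero : ∑ s, c 0 s * f s = f r := by
    rw [Finset.sum_eq_single r (fun s _ hs => by simp [c, h.avoidProb_zero_of_ne hs]) (by simp)]
    simp [c, h.avoidProb_zero_self hr]
  -- One step of the killed chain lowers the pairing with `f` by the survival probability, so the
  -- survival probabilities telescope.
  have hstep : ∀ k, ∑ s, c k s * f s = ∑ s, c k s + ∑ s, c (k + 1) s * f s := by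
    intro k
    have h1 : ∀ s, c k s * f s = c k s + ∑ u, c k s * p s u * f u := fun s => by
      by_cases hs : s ∈ N
      · simp [hcN k s hs]
      · have := hf s hs
        rw [defect] at this
        simp only [mul_assoc, ← Finset.mul_sum]
        linear_combination c k s * this
    have h2 : ∀ u, c (k + 1) u * f u = ∑ s, c k s * p s u * f u := fun u => by
      by_cases hu : u ∈ N
      · simp [hfN u hu]
      · rw [hcsucc k u hu, Finset.sum_mul]
    rw [Finset.sum_congr rfl fun s _ => h1 s, Finset.sum_congr rfl fun s _ => h2 s,
      Finset.sum_add_distrib, Finset.sum_comm (f := fun s u => c k s * p s u * f u)]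
  have hpart : ∀ k, ∑ l ∈ Finset.range k, ∑ s, c l s = f r - ∑ s, c k s * f s := by
    intro k
    induction k with
    | zero => simp [hczero]
    | succ k ih => rw [Finset.sum_range_succ, ih, hstep k]; ring
  have ha0 : ∀ k, 0 ≤ ∑ s, c k s := fun k => Finset.sum_nonneg fun s _ => hc0 k s
  have hsummable : Summable fun k => ∑ s, c k s := by
    refine summable_of_sum_range_le (c := f r) ha0 fun k => ?_
    rw [hpart]
    have := Finset.sum_nonneg fun s (_ : s ∈ Finset.univ) => mul_nonneg (hc0 k s) (hf0 s)
    linarith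
  -- The remainder is at most the survival probability times the sum of `f`, and the survival
  -- probabilities are summable.
  have hrem : Tendsto (fun k => ∑ s, c k s * f s) atTop (𝓝 0) := by
    have h1 : Tendsto (fun k => (∑ s, c k s) * ∑ s, f s) atTop (𝓝 0) := by
      simpa using hsummable.tendsto_atTop_zero.mul_const (∑ s, f s)
    refine squeeze_zero (fun k => Finset.sum_nonneg fun s _ => mul_nonneg (hc0 k s) (hf0 s))
      (fun k => ?_) h1
    rw [Finset.sum_mul]
    exact Finset.sum_le_sum fun s _ => mul_le_mul_of_nonneg_left
      (Finset.single_le_sum (fun s _ => hf0 s) (Finset.mem_univ s)) (hc0 k s)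
  have hhas : HasSum (fun k => ∑ s, c k s) (f r) := by
    rw [hasSum_iff_tendsto_nat_of_nonneg ha0]
    simp only [hpart]
    simpa using hrem.const_sub (f r)
  rw [h.expectedTime_eq_tsum hr, ← hhas.tsum_eq, ENNReal.ofReal_tsum_of_nonneg ha0 hsummable]
  refine tsum_congr fun k => ?_
  rw [ENNReal.ofReal_sum_of_nonneg fun s _ => hc0 k s]
  exact Finset.sum_congr rfl fun s _ => (ENNReal.ofReal_toReal (hfin k s)).symm

end IsMarkovChain

end ExitTime

/-! ### Low temperature asymptotics -/

namespace IsEnergyDrivenChain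

variable {S : Type*} [Fintype S] {G : SimpleGraph S} {E : S → ℝ} {P : ℝ → Matrix S S ℝ}
  {π : ℝ → S → ℝ} {γ : ℝ → ℝ} {M : Set S} {a r s u x : S}

/-- The inverse temperature 1 stands for any positive one; loops in a transition path are skipped.
-/
theorem connected (hP : IsEnergyDrivenChain G E P π γ) : G.Connected := by
  have hne : Nonempty S := by
    by_contra h
    rw [not_nonempty_iff] at h
    simpa using hP.stationary_sum 1 one_pos
  refine ⟨fun r s => ?_⟩
  let _ : Quiver S := (P 1).toQuiver
  obtain ⟨q, -⟩ := (hP.irreducible 1 one_pos).connected r s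
  induction q with
  | nil => exact .refl _
  | @cons b c _ e ih =>
    refine ih.trans ?_
    by_cases hbc : b = c
    · rw [hbc]
    · exact ((hP.pos_iff_adj 1 one_pos b c hbc).1 e.down).reachable

theorem isReversibleChain (hP : IsEnergyDrivenChain G E P π γ) {β : ℝ} (hβ : 0 < β) :
    IsReversibleChain G (P β) (π β) where
  connected := hP.connected
  nonneg := (hP.irreducible β hβ).nonneg
  row_sum := hP.row_sum β hβ
  pos r s hrs := (hP.pos_iff_adj β hβ r s hrs.ne).2 hrs
  eq_zero r s hrs hadj := le_antisymm
    (not_lt.1 fun h => hadj ((hP.pos_iff_adj β hβ r s hrs).1 h)) ((hP.irreducible β hβ).nonneg r s)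
  weight_pos r := by
    refine lt_of_le_of_ne (hP.stationary_nonneg β hβ r) fun h0 => ?_
    have hall : ∀ s, π β s = 0 := fun s => by
      obtain ⟨walk⟩ := hP.connected.preconnected r s
      have hl : Linked G (fun _ => True) r s := ⟨walk, fun _ _ => trivial⟩
      refine hl.spread (R := fun v => π β v = 0) h0.symm fun a b ha hab _ => ?_
      have h1 := hP.detailed_balance β hβ a b
      rw [ha, zero_mul] at h1
      exact (mul_eq_zero.1 h1.symm).resolve_right
        ((hP.pos_iff_adj β hβ b a hab.symm.ne).2 hab.symm).ne'
    have hsum := hP.stationary_sum β hβ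
    simp [hall] at hsum
  balance := hP.detailed_balance β hβ

/-- Comparison of the stationary weights with the Gibbs weights. -/
theorem eventually_weight_le (hP : IsEnergyDrivenChain G E P π γ) :
    ∀ᶠ β in atTop, ∀ a b, π β a ≤ π β b * Real.exp (-β * (E a - E b) + 2 * (β * γ β)) := by
  filter_upwards [hP.lower_bound, hP.upper_bound, eventually_gt_atTop 0] with β hlow hup hβ a b
  have h := hP.isReversibleChain hβ
  have hS : (0 : ℝ) < Fintype.card S := by
    have : Nonempty S := ⟨a⟩
    exact_mod_cast Fintype.card_pos
  have hγ := hP.gamma_pos β hβ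
  obtain ⟨walk⟩ := hP.connected.preconnected a b
  have hl : Linked G (fun _ => True) a b := ⟨walk, fun _ _ => trivial⟩
  have hB : 0 ≤ 2 * (β * γ β) / Fintype.card S := by positivity
  -- Detailed balance bounds the change of `log π + β E` along an edge by `2 β γ / |S|`; a path has
  -- fewer than `|S|` edges, which removes the denominator.
  have key := hl.sub_le (g := fun v => Real.log (π β v) + β * E v) hB fun c d hcd _ _ => by
    have h1 := congrArg Real.log (h.balance c d)
    rw [Real.log_mul (h.weight_pos c).ne' (h.pos c d hcd).ne',
      Real.log_mul (h.weight_pos d).ne' (h.pos d c hcd.symm).ne'] at h1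
    have h2 := Real.log_le_log (Real.exp_pos _) (hlow c d hcd)
    have h3 := Real.log_le_log (h.pos d c hcd.symm) (hup d c hcd.symm)
    rw [Real.log_exp] at h2 h3
    have h4 : max (E d - E c) 0 - max (E c - E d) 0 = E d - E c := by
      rcases le_total (E c) (E d) with h | h
      · rw [max_eq_left (by linarith), max_eq_right (by linarith)]
        ring
      · rw [max_eq_right (by linarith), max_eq_left (by linarith)]
        ring
    have h5 : β * max (E d - E c) 0 - β * max (E c - E d) 0 = β * E d - β * E c := by
      rw [← mul_sub, h4, mul_sub]
    have h6 : 2 * (β * γ β) / Fintype.card S = 2 * (β * (γ β / Fintype.card S)) := by ring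
    rw [h6]
    linarith
  rw [mul_div_cancel₀ _ hS.ne'] at key
  rw [← Real.log_le_log_iff (h.weight_pos a) (mul_pos (h.weight_pos b) (Real.exp_pos _)),
    Real.log_mul (h.weight_pos b).ne' (Real.exp_pos _).ne', Real.log_exp]
  linarith

/-- The conductances are governed by the larger energy of the edge. -/
theorem eventually_conductance (hP : IsEnergyDrivenChain G E P π γ) :
    ∀ᶠ β in atTop, ∀ r a b, G.Adj a b →
      π β r * Real.exp (-β * (max (E a) (E b) - E r) - 3 * (β * γ β)) ≤ π β a * P β a b ∧
      π β a * P β a b ≤ π β r * Real.exp (-β * (max (E a) (E b) - E r) + 3 * (β * γ β)) := by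
  filter_upwards [hP.lower_bound, hP.upper_bound, hP.eventually_weight_le,
    eventually_gt_atTop 0] with β hlow hup hw hβ r a b hab
  have h := hP.isReversibleChain hβ
  have hS : (1 : ℝ) ≤ Fintype.card S := by
    have : Nonempty S := ⟨a⟩
    exact_mod_cast Fintype.card_pos
  have hγ : γ β / Fintype.card S ≤ γ β := div_le_self (hP.gamma_pos β hβ).le hS
  have hβγ := mul_le_mul_of_nonneg_left hγ hβ.le
  have hmax : max (E a) (E b) = E a + max (E b - E a) 0 := by
    rcases le_total (E a) (E b) with h | h
    · rw [max_eq_right h, max_eq_left (by linarith)]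
      ring
    · rw [max_eq_left h, max_eq_right (by linarith)]
      ring
  rw [hmax]
  -- The constant 3 consists of 2 from comparing weights and 1 from the transition probability.
  constructor
  · refine (mul_le_mul_of_nonneg_right (hw r a) (Real.exp_pos _).le).trans ?_
    rw [mul_assoc, ← Real.exp_add]
    refine mul_le_mul_of_nonneg_left ((Real.exp_le_exp.2 ?_).trans (hlow a b hab))
      (h.weight_pos a).le
    linarith
  · refine (mul_le_mul (hw a r) (hup a b hab) (h.nonneg a b) (mul_nonneg (h.weight_pos r).le
      (Real.exp_pos _).le)).trans ?_
    rw [mul_assoc, ← Real.exp_add]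
    refine mul_le_mul_of_nonneg_left (Real.exp_le_exp.2 ?_) (h.weight_pos r).le
    linarith

/-- A chain started at `r` reaches a set `T` in the lake of height `H` around `r` before it leaves
the lake, with high probability. -/
theorem eventually_harmonic_le (hP : IsEnergyDrivenChain G E P π γ) {H : ℝ} {T : Set S}
    (hT : T ⊆ {v | saddleEnergy G E r v ≤ H}) (hne : T.Nonempty) :
    ∀ᶠ β in atTop, ∀ φ : S → ℝ,
      (∀ v ∈ {v | saddleEnergy G E r v ≤ H} \ T, defect (P β) φ v = 0) →
      (∀ v ∈ T, φ v = 0) → (∀ v, ¬ saddleEnergy G E r v ≤ H → φ v = 1) → φ r ≤ 1 / 2 := by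
  have hG := hP.connected
  obtain ⟨t, ht⟩ := hne
  have hrH : E r ≤ H := (left_le_saddleEnergy hG r t).trans (hT ht)
  -- `H'` is the next energy value above `H`, so every edge leaving the lake has height at least
  -- `H'`; if there is none, `H + 1` serves.
  obtain ⟨H', hH', hgap⟩ : ∃ H', H < H' ∧ ∀ b, H < E b → H' ≤ E b := by
    by_cases hex : ∃ b, H < E b
    · obtain ⟨b, hb, hmin⟩ := Set.exists_min_image {b | H < E b} E (Set.toFinite _) hex
      exact ⟨E b, hb, hmin⟩
    · exact ⟨H + 1, by linarith, fun b hb => absurd ⟨b, hb⟩ hex⟩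
  have hlim : Tendsto (fun β => (Fintype.card S : ℝ) ^ 3 * Real.exp (-(β * ((H' - H) / 2)))) atTop
      (𝓝 0) := by
    have h1 : Tendsto (fun β : ℝ => β * ((H' - H) / 2)) atTop atTop :=
      tendsto_id.atTop_mul_const (by linarith)
    simpa using (Real.tendsto_exp_neg_atTop_nhds_zero.comp h1).const_mul
      ((Fintype.card S : ℝ) ^ 3)
  filter_upwards [hP.eventually_conductance, eventually_gt_atTop 0,
    hlim.eventually_le_const (show (0 : ℝ) < 1 / 2 by norm_num),
    -- The two conductance bounds cost `6 β γ` in total, at most half of `β (H' - H)`.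
    hP.gamma_tendsto.eventually_le_const (show (0 : ℝ) < (H' - H) / 12 by linarith)]
    with β hcond hβ hhalf hγ φ hφ hφT hφW
  have h := hP.isReversibleChain hβ
  by_cases hrT : r ∈ T
  · rw [hφT r hrT]
    norm_num
  have hz : t ∉ {v | saddleEnergy G E r v ≤ H} \ T := fun h => h.2 ht
  have hrW : saddleEnergy G E r r ≤ H := by rwa [saddleEnergy_self hG]
  obtain ⟨g, hg⟩ := h.exists_green hz ⟨hrW, hrT⟩
  have h1 := hg.self_le h hz (Real.exp_pos (-β * (H - E r) - 3 * (β * γ β)))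
    ((saddleEnergy_le_iff hG).1 (hT ht)) fun a b hab ha hb => by
      refine (mul_le_mul_of_nonneg_left (Real.exp_le_exp.2 ?_) (h.weight_pos r).le).trans
        (hcond r a b hab).1
      have := mul_le_mul_of_nonneg_left (max_le ha hb) hβ.le
      linarith
  have h2 := hg.harmonic_le h hz hφ hφT hφW
    (Real.exp_pos (-β * (H' - E r) + 3 * (β * γ β))).le fun a ha b hb => by
      have hne : a ≠ b := by rintro rfl; exact hb ha
      by_cases hab : G.Adj a b
      · refine (hcond r a b hab).2.trans
          (mul_le_mul_of_nonneg_left (Real.exp_le_exp.2 ?_) (h.weight_pos r).le)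
        have haE : E a ≤ H := (right_le_saddleEnergy hG r a).trans ha
        have hbE : H < E b := by
          by_contra! hbE
          exact hb (saddleEnergy_trans hG ha (saddleEnergy_adj_le hG hab haE hbE))
        have := mul_le_mul_of_nonneg_left ((hgap b hbE).trans (le_max_right (E a) (E b))) hβ.le
        linarith
      · rw [h.eq_zero a b hne hab, mul_zero]
        exact mul_nonneg (h.weight_pos r).le (Real.exp_pos _).le
  refine h2.trans ((mul_le_mul_of_nonneg_left h1 (by positivity)).trans (le_trans ?_ hhalf))
  rw [← Real.exp_neg]
  have h3 : (Fintype.card S : ℝ) ^ 2 * Real.exp (-β * (H' - E r) + 3 * (β * γ β)) *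
      (Fintype.card S * Real.exp (-(-β * (H - E r) - 3 * (β * γ β)))) =
      (Fintype.card S : ℝ) ^ 3 * (Real.exp (-β * (H' - E r) + 3 * (β * γ β)) *
        Real.exp (-(-β * (H - E r) - 3 * (β * γ β)))) := by ring
  rw [h3, ← Real.exp_add]
  refine mul_le_mul_of_nonneg_left (Real.exp_le_exp.2 ?_) (by positivity)
  have := mul_le_mul_of_nonneg_left hγ hβ.le
  linarith

/-- A solution of the Dirichlet problem of `eventually_harmonic_le`. -/
theorem exists_harmonic (hP : IsEnergyDrivenChain G E P π γ) {β : ℝ} (hβ : 0 < β) {W T : Set S}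
    (hT : T ⊆ W) (hne : T.Nonempty) : ∃ φ : S → ℝ, (∀ v ∈ W \ T, defect (P β) φ v = 0) ∧
      (∀ v ∈ T, φ v = 0) ∧ (∀ v ∉ W, φ v = 1) := by
  classical
  obtain ⟨t, ht⟩ := hne
  obtain ⟨φ, h1, h2⟩ := (hP.isReversibleChain hβ).exists_defect_eq (U := W \ T)
    (fun h : t ∈ W \ T => h.2 ht) fun v => if v ∈ W then 0 else 1
  refine ⟨φ, fun v hv => ?_, fun v hv => ?_, fun v hv => ?_⟩
  · rw [h1 v hv, if_pos hv.1]
  · rw [h2 v fun h => h.2 hv, if_pos (hT hv)]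
  · rw [h2 v fun h => hv h.1, if_neg hv]

theorem defect_mul_one_sub (hP : IsEnergyDrivenChain G E P π γ) {β : ℝ} (hβ : 0 < β) (c : ℝ)
    {φ : S → ℝ} {v : S} (hφ : defect (P β) φ v = 0) :
    defect (P β) (fun v => c * (1 - φ v)) v = 0 := by
  rw [defect_smul c (fun v => 1 - φ v) v, defect_sub (fun _ => 1) φ v,
    (hP.isReversibleChain hβ).defect_const, hφ, sub_zero, mul_zero]

/-- Superharmonic functions in a strict basin. -/
theorem eventually_le_of_mem_strictBasin (hP : IsEnergyDrivenChain G E P π γ)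
    (hu : u ∈ strictBasin G E M a) : ∀ᶠ β in atTop, ∀ f : S → ℝ, (∀ v, 0 ≤ f v) →
      (∀ v ∈ strictBasin G E M a, 0 ≤ defect (P β) f v) → f a ≤ 2 * f u := by
  have hG := hP.connected
  have hT : {a} ⊆ {v | saddleEnergy G E u v ≤ saddleEnergy G E u a} := by
    rintro _ rfl
    exact le_refl (saddleEnergy G E u _)
  filter_upwards [hP.eventually_harmonic_le hT ⟨a, rfl⟩, eventually_gt_atTop 0]
    with β hharm hβ f hf0 hf
  have h := hP.isReversibleChain hβ
  obtain ⟨φ, hφ, hφT, hφW⟩ := hP.exists_harmonic hβ hT ⟨a, rfl⟩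
  have hhalf := hharm φ hφ hφT hφW
  by_cases hua : u = a
  · rw [hua]
    linarith [hf0 a]
  -- `1 - φ` is the probability of hitting `a` before leaving the lake, and a nonnegative
  -- superharmonic `f` dominates `f a` times it.
  have key := h.le_of_defect_le (z := a)
    (U := {v | saddleEnergy G E u v ≤ saddleEnergy G E u a} \ {a})
    (f := fun v => f a * (1 - φ v)) (g := f) (fun h => h.2 rfl) ?_ ?_ u
    ⟨(saddleEnergy_self hG u).trans_le (left_le_saddleEnergy hG u a), hua⟩
  · have h1 := mul_le_mul_of_nonneg_left (show 1 / 2 ≤ 1 - φ u by linarith) (hf0 a)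
    linarith
  · intro v hv
    rw [hP.defect_mul_one_sub hβ _ (hφ v hv)]
    exact hf v (strictBasin_of_le hG hu hv.1)
  · intro _ _ s hs _
    by_cases hsa : s = a
    · rw [hsa, hφT a rfl, sub_zero, mul_one]
    · rw [hφW s fun h => hs ⟨h, hsa⟩, sub_self, mul_zero]
      exact hf0 s

/-- Superharmonic functions on a set of attracted states. -/
theorem eventually_le_of_attracted (hP : IsEnergyDrivenChain G E P π γ)
    (hM : M ⊆ localMinima G E) (hs : Attracted G E M s a) :
    ∀ᶠ β in atTop, ∀ f : S → ℝ, (∀ v, 0 ≤ f v) →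
      (∀ v, Attracted G E M v a → 0 ≤ defect (P β) f v) → f a ≤ 4 * f s := by
  have hG := hP.connected
  have haB := self_mem_strictBasin hG hM hs.1
  have hne : ({v | saddleEnergy G E s v ≤ saddleEnergy G E s a} ∩
      strictBasin G E M a).Nonempty := ⟨a, le_refl (saddleEnergy G E s a), haB⟩
  have hbasin : ∀ᶠ β in atTop, ∀ u, u ∈ strictBasin G E M a → ∀ f : S → ℝ, (∀ v, 0 ≤ f v) →
      (∀ v ∈ strictBasin G E M a, 0 ≤ defect (P β) f v) → f a ≤ 2 * f u := by
    rw [eventually_all]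
    intro u
    by_cases hu : u ∈ strictBasin G E M a
    · filter_upwards [hP.eventually_le_of_mem_strictBasin hu] with β h _ using h
    · exact .of_forall fun _ h => absurd h hu
  filter_upwards [hP.eventually_harmonic_le Set.inter_subset_left hne, hbasin,
    eventually_gt_atTop 0] with β hharm hbas hβ f hf0 hf
  have h := hP.isReversibleChain hβ
  obtain ⟨φ, hφ, hφT, hφW⟩ := hP.exists_harmonic hβ Set.inter_subset_left hne
  have hhalf := hharm φ hφ hφT hφW
  have hB : ∀ u ∈ strictBasin G E M a, f a ≤ 2 * f u := fun u hu =>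
    hbas u hu f hf0 fun v hv => hf v (attracted_of_mem_strictBasin hs.1 hv)
  have hsE : E s ≤ saddleEnergy G E s a := left_le_saddleEnergy hG s a
  by_cases hsB : s ∈ strictBasin G E M a
  · linarith [hB s hsB, hf0 s]
  -- The comparison is made on the part of the lake reached from `s` without entering the strict
  -- basin, because these states are known to be attracted by `a`. Its boundary lies in the basin,
  -- where `f a / 2 ≤ f`, or above the saddle, where `1 - φ` vanishes.
  have key := h.le_of_defect_le (z := a)
    (U := {v | Linked G (fun v => E v ≤ saddleEnergy G E s a ∧ v ∉ strictBasin G E M a) s v})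
    (f := fun v => f a / 2 * (1 - φ v)) (g := f) (fun h => h.right.2 haB) ?_ ?_ s
    (Linked.refl ⟨hsE, hsB⟩)
  · have h1 := mul_le_mul_of_nonneg_left (show 1 / 2 ≤ 1 - φ s by linarith)
      (show 0 ≤ f a / 2 by linarith [hf0 a])
    linarith
  · intro v hv
    rw [hP.defect_mul_one_sub hβ]
    · exact hf v (hs.of_linked hG hv)
    · exact hφ v ⟨(saddleEnergy_le_iff hG).2 (hv.mono fun _ h => h.1), fun h => hv.right.2 h.2⟩
  · intro v hv t ht hvt
    have hsv : saddleEnergy G E s v ≤ saddleEnergy G E s a :=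
      (saddleEnergy_le_iff hG).2 (hv.mono fun _ h => h.1)
    rcases le_or_gt (E t) (saddleEnergy G E s a) with htE | htE
    · have htB : t ∈ strictBasin G E M a := by
        by_contra htB
        exact ht (hv.trans (.adj hvt hv.right ⟨htE, htB⟩))
      have hst := saddleEnergy_trans hG hsv (saddleEnergy_adj_le hG hvt hv.right.1 htE)
      rw [hφT t ⟨hst, htB⟩]
      linarith [hB t htB]
    · rw [hφW t fun h => htE.not_ge ((right_le_saddleEnergy hG s t).trans h), sub_self, mul_zero]
      exact hf0 t

/-- Superharmonic functions in a valley. -/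
theorem eventually_le_of_mem_valley (hP : IsEnergyDrivenChain G E P π γ) {m : ℕ → S} {n k : ℕ}
    (hm : IsMetastableOrder G E m n) (hk : 1 ≤ k) (hs : s ∈ valley G E m n k x) :
    ∃ c : ℝ, 0 < c ∧ ∀ᶠ β in atTop, ∀ f : S → ℝ, (∀ v, 0 ≤ f v) →
      (∀ v ∈ valley G E m n k x, 0 ≤ defect (P β) f v) → f x ≤ c * f s := by
  have hG := hP.connected
  refine valley_induction (p := fun k x s => ∃ c : ℝ, 0 < c ∧ ∀ᶠ β in atTop, ∀ f : S → ℝ,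
    (∀ v, 0 ≤ f v) → (∀ v ∈ valley G E m n k x, 0 ≤ defect (P β) f v) → f x ≤ c * f s)
    ?_ ?_ ?_ hk hs
  · intro k x s hk hs
    refine ⟨4, by norm_num, ?_⟩
    filter_upwards [hP.eventually_le_of_attracted (hm.subset hk) hs] with β h f hf0 hf
    exact h f hf0 fun v hv => hf v (mem_valley_of_attracted hG hm hk hv)
  · rintro k x s hk - ⟨c, hc, h⟩
    refine ⟨c, hc, ?_⟩
    filter_upwards [h] with β h f hf0 hf
    exact h f hf0 fun v hv => hf v (valley_mono hk (Nat.le_succ k) hv)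
  · rintro k j x s hj hjk hlev hjx - ⟨c, hc, h⟩
    have hk : 1 ≤ k := by omega
    refine ⟨4 * c, by positivity, ?_⟩
    filter_upwards [h, hP.eventually_le_of_attracted (hm.subset hk) hjx] with β h h' f hf0 hf
    have h1 := h f hf0 fun v hv => hf v (valley_subset_of_merge hj hlev hjx hv)
    have h2 := h' f hf0 fun v hv => hf v (mem_valley_of_attracted hG hm hk hv)
    linarith

end IsEnergyDrivenChain

/-! ### Exponential bounds for exit times from valleys. -/

namespace IsEnergyDrivenChain

variable {S : Type*} [Fintype S] {G : SimpleGraph S} {E : S → ℝ} {P : ℝ → Matrix S S ℝ}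
  {π : ℝ → S → ℝ} {γ : ℝ → ℝ} {m : ℕ → S} {n i : ℕ} {r s x y : S}

/-- Upper bound for the solutions of the exit time equation of a valley. -/
theorem eventually_exit_le (hP : IsEnergyDrivenChain G E P π γ)
    (hm : IsMetastableOrder G E m n) (hi : 1 ≤ i) (hin : i < n) (hx : x ∈ metastable m n i)
    (hy : y ∈ metastable m n i) (hyx : y ≠ x) :
    ∀ᶠ β in atTop, ∀ f : S → ℝ, (∀ v ∈ valley G E m n i x, defect (P β) f v = 1) →
      (∀ v ∉ valley G E m n i x, f v = 0) → ∀ r, f r ≤ (Fintype.card S : ℝ) ^ 2 *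
        Real.exp (β * (saddleEnergy G E x y - E x) + 3 * (β * γ β)) := by
  have hG := hP.connected
  have hyV : y ∉ valley G E m n i x := fun h => hyx (eq_of_mem_valley hG hm hi hy h hx)
  filter_upwards [hP.eventually_conductance, eventually_gt_atTop 0] with β hcond hβ f hf hf0 r
  have h := hP.isReversibleChain hβ
  refine (h.le_of_green_le hyV hf hf0 (C := Fintype.card S *
    Real.exp (β * (saddleEnergy G E x y - E x) + 3 * (β * γ β))) (by positivity) ?_ r).trans_eq
    (by ring)
  intro u _ g hg
  obtain ⟨w, hwV, hw⟩ := exists_saddleEnergy_sub_le hG hP.nondegenerate hm hi hin hx hy hyx u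
  refine (hg.self_le h hwV (Real.exp_pos (-(β * (saddleEnergy G E x y - E x) + 3 * (β * γ β))))
    (linked_saddleEnergy (E := E) hG u w) fun a b hab ha hb => ?_).trans_eq ?_
  · refine (mul_le_mul_of_nonneg_left (Real.exp_le_exp.2 ?_) (h.weight_pos u).le).trans
      (hcond u a b hab).1
    have h1 : max (E a) (E b) - E u ≤ saddleEnergy G E x y - E x := by
      linarith [max_le ha hb]
    have := mul_le_mul_of_nonneg_left h1 hβ.le
    linarith
  · rw [← Real.exp_neg, neg_neg]

/-- Lower bound for the solutions of the exit time equation of a valley. -/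
theorem eventually_le_exit (hP : IsEnergyDrivenChain G E P π γ)
    (hm : IsMetastableOrder G E m n) (hi : 1 ≤ i) (hx : x ∈ metastable m n i)
    (hy : y ∈ metastable m n i) (hyx : y ≠ x)
    (hmin : ∀ z ∈ metastable m n i, z ≠ x → saddleEnergy G E x y ≤ saddleEnergy G E x z)
    (hr : r ∈ valley G E m n i x) :
    ∃ c : ℝ, 0 < c ∧ ∀ᶠ β in atTop, ∀ f : S → ℝ, (∀ v, 0 ≤ f v) →
      (∀ v ∈ valley G E m n i x, defect (P β) f v = 1) → (∀ v ∉ valley G E m n i x, f v = 0) →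
      c * Real.exp (β * (saddleEnergy G E x y - E x) - 3 * (β * γ β)) ≤ f r := by
  classical
  have hG := hP.connected
  have hyV : y ∉ valley G E m n i x := fun h => hyx (eq_of_mem_valley hG hm hi hy h hx)
  obtain ⟨c, hc, hval⟩ := hP.eventually_le_of_mem_valley hm hi hr
  have hS : (0 : ℝ) < Fintype.card S := by
    have : Nonempty S := ⟨x⟩
    exact_mod_cast Fintype.card_pos
  refine ⟨((Fintype.card S : ℝ) ^ 2 * c)⁻¹, by positivity, ?_⟩
  filter_upwards [hP.eventually_conductance, hval, eventually_gt_atTop 0]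
    with β hcond hval hβ f hf0 hf hfV
  have h := hP.isReversibleChain hβ
  obtain ⟨g, hg⟩ := h.exists_green hyV (self_mem_valley hG hm hi hx)
  -- The cut is the lake of `x` strictly below its lowest saddle to another metastable state; every
  -- edge leaving it reaches at least that height.
  let W : Finset S := Finset.univ.filter fun v => saddleEnergy G E x v < saddleEnergy G E x y
  have hW : ∀ v, v ∈ W ↔ saddleEnergy G E x v < saddleEnergy G E x y := fun v => by simp [W]
  have hxW : x ∈ W := by
    rw [hW, saddleEnergy_self hG]
    exact lt_saddleEnergy_of_localMin hG (hm.subset hi hx) hyx.symm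
  have hgx := hg.one_le_self_mul h hyV (κ := Real.exp
    (-(β * (saddleEnergy G E x y - E x) - 3 * (β * γ β)))) W hxW
    (fun v hv => mem_valley_of_saddleEnergy_lt hG hm hi hx hmin ((hW v).1 hv))
    (Real.exp_pos _).le ?_
  · have h1 := h.green_le hyV hg hf hfV x
    have h2 := hval f hf0 fun v hv => (hf v hv).symm ▸ zero_le_one
    have h3 : 1 ≤ Fintype.card S ^ 2 *
        Real.exp (-(β * (saddleEnergy G E x y - E x) - 3 * (β * γ β))) * (c * f r) :=
      hgx.trans (mul_le_mul_of_nonneg_left (h1.trans h2) (by positivity))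
    rw [Real.exp_neg] at h3
    have hexp := Real.exp_pos (β * (saddleEnergy G E x y - E x) - 3 * (β * γ β))
    rw [inv_mul_le_iff₀ (by positivity), ← mul_le_mul_iff_right₀ (inv_pos.2 hexp),
      inv_mul_cancel₀ hexp.ne']
    exact h3.trans_eq (by ring)
  · intro a ha b hb
    have hne : a ≠ b := by rintro rfl; exact hb ha
    by_cases hab : G.Adj a b
    · refine (hcond x a b hab).2.trans
        (mul_le_mul_of_nonneg_left (Real.exp_le_exp.2 ?_) (h.weight_pos x).le)
      have hbE : saddleEnergy G E x y ≤ max (E a) (E b) := by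
        by_contra! hlt
        rw [hW] at ha hb
        exact hb (saddleEnergy_trans_lt hG ha
          ((saddleEnergy_adj_le hG hab (le_max_left _ _) (le_max_right _ _)).trans_lt hlt))
      have := mul_le_mul_of_nonneg_left hbE hβ.le
      linarith
    · rw [h.eq_zero a b hne hab, mul_zero]
      exact mul_nonneg (h.weight_pos x).le (Real.exp_pos _).le

end IsEnergyDrivenChain

/-! ### Logarithmic rate, identification with the boundary problem, and conclusion. -/

/-- The exponential rate of a function between two exponential bounds. -/
theorem tendsto_log_div_of_bounds {F γ : ℝ → ℝ} {A c C : ℝ} (hc : 0 < c) (hC : 0 < C)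
    (hγ : Tendsto γ atTop (𝓝 0))
    (hlow : ∀ᶠ β in atTop, c * Real.exp (β * A - 3 * (β * γ β)) ≤ F β)
    (hup : ∀ᶠ β in atTop, F β ≤ C * Real.exp (β * A + 3 * (β * γ β))) :
    Tendsto (fun β => 1 / β * Real.log (F β)) atTop (𝓝 A) := by
  have hlim : ∀ a b : ℝ, Tendsto (fun β => a * β⁻¹ + (A + b * γ β)) atTop (𝓝 A) := fun a b => by
    simpa using (tendsto_inv_atTop_zero.const_mul a).add ((hγ.const_mul b).const_add A)
  refine tendsto_of_tendsto_of_tendsto_of_le_of_le' (hlim (Real.log c) (-3)) (hlim (Real.log C) 3)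
    ?_ ?_
  · filter_upwards [hlow, eventually_gt_atTop 0] with β h hβ
    have h1 := Real.log_le_log (mul_pos hc (Real.exp_pos _)) h
    rw [Real.log_mul hc.ne' (Real.exp_pos _).ne', Real.log_exp] at h1
    refine le_trans (le_of_eq ?_) (mul_le_mul_of_nonneg_left h1 (by positivity))
    field_simp
    ring
  · filter_upwards [hlow, hup, eventually_gt_atTop 0] with β h h' hβ
    have h1 := Real.log_le_log ((mul_pos hc (Real.exp_pos _)).trans_le h) h'
    rw [Real.log_mul hC.ne' (Real.exp_pos _).ne', Real.log_exp] at h1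
    refine (mul_le_mul_of_nonneg_left h1 (by positivity)).trans (le_of_eq ?_)
    field_simp

/-- The expected exit time from a valley solves the exit time equation of the valley. -/
theorem exists_exit_solution {S Ω : Type*} [Fintype S] {G : SimpleGraph S} {E : S → ℝ}
    {m : ℕ → S} {n i : ℕ} {x : S} {p : Matrix S S ℝ} {w : S → ℝ}
    (h : IsReversibleChain G p w) (hm : IsMetastableOrder G E m n) (hi : 1 ≤ i)
    (hx : x ∈ metastable m n i) (hne : (outerBoundary G (valley G E m n i x)).Nonempty)
    [MeasurableSpace Ω] {X : ℕ → Ω → S} {μ : S → Measure Ω}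
    (hX : ∀ r, IsMarkovChain (μ r) X p r) :
    ∃ f : S → ℝ, (∀ v, 0 ≤ f v) ∧ (∀ v ∈ valley G E m n i x, defect p f v = 1) ∧
      (∀ v ∉ valley G E m n i x, f v = 0) ∧ ∀ r ∈ valley G E m n i x,
        expectedTime (μ r) (exitTime X (nonAssigned G E m n i)) = ENNReal.ofReal (f r) := by
  classical
  have hG := h.connected
  have hbd : ∀ s ∈ valley G E m n i x, ∀ t ∉ valley G E m n i x, G.Adj s t →
      t ∈ nonAssigned G E m n i := fun s hs t ht hst =>
    mem_nonAssigned_of_adj hG hm hi hx hs hst ht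
  obtain ⟨z, hz, s, hs, hsz⟩ := hne
  have hzN := hbd s hs z hz hsz
  have hV : ∀ r ∈ valley G E m n i x, r ∉ nonAssigned G E m n i := by
    intro r hr hrN
    obtain ⟨q, hq, rfl⟩ := hx
    have := hq.1
    exact mem_nonAssigned.1 hrN q (by omega) hq.2 (by rwa [min_eq_left hq.1])
  have hsol : ∀ U : Set S, z ∉ U → ∃ f : S → ℝ, (∀ v, 0 ≤ f v) ∧
      (∀ v ∈ U, defect p f v = 1) ∧ ∀ v ∉ U, f v = 0 := by
    intro U hzU
    obtain ⟨f, hf, hf0⟩ := h.exists_defect_eq hzU fun v => if v ∈ U then 1 else 0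
    have hf : ∀ v ∈ U, defect p f v = 1 := fun v hv => by rw [hf v hv, if_pos hv]
    have hf0 : ∀ v ∉ U, f v = 0 := fun v hv => by rw [hf0 v hv, if_neg hv]
    refine ⟨f, fun v => ?_, hf, hf0⟩
    by_cases hv : v ∈ U
    · exact h.nonneg_of_defect_nonneg hzU (fun v hv => (hf v hv).symm ▸ zero_le_one)
        (fun _ _ t ht _ => (hf0 t ht).ge) v hv
    · exact (hf0 v hv).ge
  -- `F` solves the equation on the complement of the non-assigned states and gives the expected
  -- time. It agrees with `f` on the valley, since all exits from the valley are non-assigned and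
  -- both functions vanish there.
  obtain ⟨f, hf, hf1, hf0⟩ := hsol _ hz
  obtain ⟨F, hF, hF1, hF0⟩ := hsol (nonAssigned G E m n i)ᶜ fun h => h hzN
  refine ⟨f, hf, hf1, hf0, fun r hr => ?_⟩
  rw [(hX r).expectedTime_eq (hV r hr) h.nonneg hF (fun s hs => hF0 s fun h => h hs) hF1]
  congr 1
  refine le_antisymm ?_ ?_
  · exact h.le_of_defect_le hz (fun v hv => by rw [hF1 v (hV v hv), hf1 v hv])
      (fun v hv t ht hvt => by rw [hf0 t ht, hF0 t fun h => h (hbd v hv t ht hvt)]) r hr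
  · exact h.le_of_defect_le hz (fun v hv => by rw [hF1 v (hV v hv), hf1 v hv])
      (fun v hv t ht hvt => by rw [hf0 t ht, hF0 t fun h => h (hbd v hv t ht hvt)]) r hr

end EnergyValleys

end

theorem mainTheorem5 {S : Type*} [Fintype S] (G : SimpleGraph S) (E : S → ℝ)
    (P : ℝ → Matrix S S ℝ) (π : ℝ → S → ℝ) (γ : ℝ → ℝ)
    (hP : EnergyValleys.IsEnergyDrivenChain G E P π γ)
    (m : ℕ → S) (n : ℕ) (hm : EnergyValleys.IsMetastableOrder G E m n)
    {Ω : Type*} [MeasurableSpace Ω] (X : ℕ → Ω → S) (ℙ : ℝ → S → Measure Ω)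
    (hX : ∀ β : ℝ, 0 < β → ∀ r, EnergyValleys.IsMarkovChain (ℙ β r) X (P β) r)
    (i : ℕ) (hi : 1 ≤ i) (hin : i < n) (x : S) (hx : x ∈ EnergyValleys.metastable m n i) :
    ∃ s ∈ EnergyValleys.outerBoundary G (EnergyValleys.valley G E m n i x),
      (∀ t ∈ EnergyValleys.outerBoundary G (EnergyValleys.valley G E m n i x), t ≠ s → E s < E t) ∧
      ∀ r ∈ EnergyValleys.valley G E m n i x,
        (∀ β : ℝ, 0 < β → EnergyValleys.expectedTime (ℙ β r)
          (EnergyValleys.exitTime X (EnergyValleys.nonAssigned G E m n i)) ≠ ⊤) ∧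
        Tendsto (fun β : ℝ => 1 / β * Real.log (EnergyValleys.expectedTime (ℙ β r)
          (EnergyValleys.exitTime X (EnergyValleys.nonAssigned G E m n i))).toReal)
          atTop (𝓝 (E s - E x)) := by
  open EnergyValleys in
  have hG := hP.connected
  obtain ⟨y, ⟨hy, hyx⟩, hmin⟩ := Set.exists_min_image (metastable m n i \ {x})
    (fun y => saddleEnergy G E x y) (Set.toFinite _) (metastable_diff_nonempty hm hi hin x)
  have hmin : ∀ z ∈ metastable m n i, z ≠ x → saddleEnergy G E x y ≤ saddleEnergy G E x z :=
    fun z hz hzx => hmin z ⟨hz, hzx⟩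
  obtain ⟨t, ht, htE⟩ := exists_mem_outerBoundary_le (E := E) hG hm hi hx hy hyx
  obtain ⟨s, hs, hsmin⟩ := Set.exists_min_image (outerBoundary G (valley G E m n i x)) E
    (Set.toFinite _) ⟨t, ht⟩
  -- The lowest boundary state has the height of the lowest saddle between `x` and another
  -- metastable state, so the two bounds have the rate claimed.
  have hsE : E s = saddleEnergy G E x y := le_antisymm ((hsmin t ht).trans htE)
    (le_of_mem_outerBoundary hG hP.nondegenerate hm hi hx hmin hs)
  refine ⟨s, hs, fun t ht hts => lt_of_le_of_ne (hsmin t ht) fun h =>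
    hts (hP.nondegenerate h.symm), fun r hr => ?_⟩
  have hsol := fun (β : ℝ) (hβ : 0 < β) =>
    exists_exit_solution (hP.isReversibleChain hβ) hm hi hx ⟨s, hs⟩ (hX β hβ)
  constructor
  · intro β hβ
    obtain ⟨f, -, -, -, hf⟩ := hsol β hβ
    rw [hf r hr]
    exact ENNReal.ofReal_ne_top
  · obtain ⟨c, hc, hlow⟩ := hP.eventually_le_exit hm hi hx hy hyx hmin hr
    have hS : (0 : ℝ) < Fintype.card S := by
      have : Nonempty S := ⟨x⟩
      exact_mod_cast Fintype.card_pos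
    rw [hsE]
    refine tendsto_log_div_of_bounds hc (pow_pos hS 2) hP.gamma_tendsto ?_ ?_
    · filter_upwards [hlow, eventually_gt_atTop 0] with β h hβ
      obtain ⟨f, hf0, hf1, hfV, hf⟩ := hsol β hβ
      rw [hf r hr, ENNReal.toReal_ofReal (hf0 r)]
      exact h f hf0 hf1 hfV
    · filter_upwards [hP.eventually_exit_le hm hi hin hx hy hyx, eventually_gt_atTop 0]
        with β h hβ
      obtain ⟨f, hf0, hf1, hfV, hf⟩ := hsol β hβ
      rw [hf r hr, ENNReal.toReal_ofReal (hf0 r)]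
      exact h f hf1 hfV r
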